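/- Let $\{p_{k,\ell}\}_{(k,\ell)\in\mathbb Z^2}$ be non-negative weights summing to $1$ such that $p_{k,\ell}=0$ if $|k|\ge 2$ or $|\ell|\ge 2$ (small steps), $p_{k,\ell}=p_{\ell,k}$ for all $k,\ell$ (symmetry), $\sum k\,p_{k,\ell}=\sum \ell\, p_{k,\ell}=0$ (zero drift), and such that $\sum p_{k,\ell}x^ky^\ell=1$ with $|x|=|y|=1$ forces $x=y=1$ (equivalently, the random walk on $\mathbb Z^2$ with these increments is irreducible). Let $$K(x,y)=xy-\sum p_{k,\ell}x^{1-k}y^{1-\ell},$$ let $\mathcal S_1=\{x\in\mathbb C:\ \exists y,\ K(x,y)=0,\ |x|=|y|\le 1\}$, and let $\mathcal S_1^+$ be the interior domain of the closed curve $\mathcal S_1$ (the bounded part of its complement). Let $\mathcal H^+=\{\Re z>0\}$ and let $\phi(z)=-\frac{z+1}{z-1}$, which maps the unit disk conformally onto $\mathcal H^+$. Let $$\theta=\arccos\frac{-\sum k\ell\, p_{k,\ell}}{\sqrt{\sum k^2p_{k,\ell}}\sqrt{\sum \ell^2p_{k,\ell}}}.$$ Write $K(x,y)=a(x)y^2+b(x)y+c(x)$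 and $d=b^2-4ac$. Then $d$ has degree $3$ or $4$, $1$ is a double root of $d$, and the remaining roots are $x_1\in[-1,1)$ and, if $\deg d=4$, $x_4\in(1,\infty)\cup(-\infty,-1]$; put $x_4=\infty$ if $\deg d=3$. So $x_1,x_4$ are uniquely determined. Put $$s_0=\frac{2-(x_1+x_4)+2\sqrt{(1-x_1)(1-x_4)}}{x_4-x_1},\qquad s_1=\frac{x_1+x_4-2x_1x_4+2\sqrt{x_1x_4(1-x_1)(1-x_4)}}{x_4-x_1},$$ with $s_0=-1$ and $s_1=1-2x_1+2\sqrt{-x_1(1-x_1)}$ if $x_4=\infty$, and $$\mu_0=s_0+\frac1{s_0},\qquad \mu_1=s_1+\frac1{s_1},\qquad \mu(x)=\frac{\mu_0x-\mu_1}{2(x-1)}$$ (the choice of the square roots does not affect $\mu_0,\mu_1$). For $a>0$ and $x\in\mathbb C\setminus(-\infty,-1]$ let $T_a(x)={}_2F_1\bigl(-a,a;\tfrac12;\tfrac{1-x}2\bigr)$, where ${}_2F_1$ is the Gauss hypergeometric function, analytically continued to $\mathbb C\setminus[1,\infty)$. Then $\mu(x)\notin(-\infty,-1]$ for $x\in\mathcal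 S_1^+$, and $$\psi_1(x)=2\,T_{\pi/\theta}(\mu(x))$$ is a conformal map from $\mathcal S_1^+$ onto $\mathcal H^+$. It is an admissible choice of the map $\psi_1$: one has $\psi_1=\phi\circ\pi_1$ on $\mathcal S_1^+$ for some conformal map $\pi_1$ from $\mathcal S_1^+$ onto the unit disk such that $\pi_1(a)=0$ and $\pi_1'(a)>0$ for some $a\in\mathcal S_1^+\cap\mathbb R$. Moreover, as an analytic function near $0$ it satisfies the normalization $\psi_1(0)=p_{1,1}$, $\psi_1'(0)>0$ up to a positive factor: $\psi_1'(0)>0$, and $C\,\psi_1(0)=p_{1,1}$ for some $C>0$. -/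

import Mathlib

open scoped OnePoint

noncomputable section

namespace QuarterPlane

/-- Sum over the eight nearest neighbours and the origin. -/
def stepSum {E : Type*} [AddCommMonoid E] (f : ℤ → ℤ → E) : E :=
  ∑ k ∈ Finset.Icc (-1 : ℤ) 1, ∑ l ∈ Finset.Icc (-1 : ℤ) 1, f k l

/-- Transition probabilities of a symmetric, irreducible, zero-drift random walk on `ℤ²` with
small steps. All weights outside `{-1, 0, 1}²` vanish, so all sums are `stepSum`s. -/
structure IsSmallStepWalk (p : ℤ → ℤ → ℝ) : Prop where
  nonneg : ∀ k l, 0 ≤ p k l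
  sum_eq_one : stepSum p = 1
  small_steps : ∀ k l, 2 ≤ |k| ∨ 2 ≤ |l| → p k l = 0
  symm : ∀ k l, p k l = p l k
  /-- Irreducibility, in terms of the characteristic function of a step. -/
  irreducible : ∀ x y : ℂ, ‖x‖ = 1 → ‖y‖ = 1 →
    stepSum (fun k l => (p k l : ℂ) * x ^ k * y ^ l) = 1 → x = 1 ∧ y = 1
  drift_fst : stepSum (fun k l => (k : ℝ) * p k l) = 0
  drift_snd : stepSum (fun k l => (l : ℝ) * p k l) = 0

/-- The kernel `K(x, y) = xy - ∑ p_{k,l} x^{1-k} y^{1-l}`; all exponents are in `{0, 1, 2}`. -/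
def kernel (p : ℤ → ℤ → ℝ) (x y : ℂ) : ℂ :=
  x * y - stepSum (fun k l => (p k l : ℂ) * x ^ (1 - k) * y ^ (1 - l))

/-- The curve `𝒮₁`: first projection of `{K(x, y) = 0, |x| = |y| ≤ 1}`. -/
def curveS (p : ℤ → ℤ → ℝ) : Set ℂ :=
  {x | ∃ y : ℂ, kernel p x y = 0 ∧ ‖x‖ = ‖y‖ ∧ ‖y‖ ≤ 1}

/-- The interior domain `𝒮₁⁺` of the curve `𝒮₁`: the points of the complement of the curve whose
connected component in that complement is bounded. -/
def interiorS (p : ℤ → ℤ → ℝ) : Set ℂ :=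
  {x | x ∈ (curveS p)ᶜ ∧ Bornology.IsBounded (connectedComponentIn (curveS p)ᶜ x)}

/-- The open right half-plane `ℋ⁺`. -/
def rightHalfPlane : Set ℂ := {z | 0 < z.re}

/-- `f` is a conformal mapping from the open set `U` onto `V`: a holomorphic bijection. -/
def IsConformalOnto (f : ℂ → ℂ) (U V : Set ℂ) : Prop :=
  DifferentiableOn ℂ f U ∧ Set.BijOn f U V

/-- The Möbius map `φ(z) = -(z+1)/(z-1)` from the unit disk onto the right half-plane. -/
def cayley (z : ℂ) : ℂ := -((z + 1) / (z - 1))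

/-- `ψ` is one of the admissible maps `ψ₁ = φ ∘ π₁ : 𝒮₁⁺ → ℋ⁺`, where `π₁` is a conformal mapping
from `𝒮₁⁺` onto the unit disk with `π₁(a) = 0` and `π₁'(a) > 0` for some real `a ∈ 𝒮₁⁺`. -/
def IsPsiOne (p : ℤ → ℤ → ℝ) (ψ : ℂ → ℂ) : Prop :=
  ∃ a : ℝ, (a : ℂ) ∈ interiorS p ∧ ∃ π₁ : ℂ → ℂ,
    IsConformalOnto π₁ (interiorS p) (Metric.ball 0 1) ∧
    π₁ a = 0 ∧ (∃ r : ℝ, 0 < r ∧ deriv π₁ a = r) ∧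
    ∀ x ∈ interiorS p, ψ x = cayley (π₁ x)

/-- The angle `θ`. -/
def angle (p : ℤ → ℤ → ℝ) : ℝ :=
  Real.arccos (-stepSum (fun k l => (k : ℝ) * l * p k l) /
    (Real.sqrt (stepSum (fun k l => (k : ℝ) ^ 2 * p k l)) *
      Real.sqrt (stepSum (fun k l => (l : ℝ) ^ 2 * p k l))))

section BranchPoints

open Polynomial

/-- The coefficient `a(x)` of `y²` in the kernel `K(x, y) = a(x) y² + b(x) y + c(x)`. -/
def kernelA (p : ℤ → ℤ → ℝ) : ℝ[X] :=
  -(C (p (-1) (-1)) * X ^ 2 + C (p 0 (-1)) * X + C (p 1 (-1)))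

/-- The coefficient `b(x)` of `y` in the kernel. -/
def kernelB (p : ℤ → ℤ → ℝ) : ℝ[X] :=
  -(C (p (-1) 0) * X ^ 2 + C (p 0 0 - 1) * X + C (p 1 0))

/-- The coefficient `c(x)` of `y⁰` in the kernel. -/
def kernelC (p : ℤ → ℤ → ℝ) : ℝ[X] :=
  -(C (p (-1) 1) * X ^ 2 + C (p 0 1) * X + C (p 1 1))

/-- The discriminant `d = b² - 4ac` of the kernel in `y`. -/
def kernelDisc (p : ℤ → ℤ → ℝ) : ℝ[X] :=
  kernelB p ^ 2 - 4 * kernelA p * kernelC p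

/-- `x₁ ∈ [-1, 1)` and `x₄ ∈ (1, ∞) ∪ {∞} ∪ (-∞, -1]` are the roots of `d` besides the double
root `1`; here `x₄ = ∞` means that `d` has degree `3`. -/
def IsBranchPoints (p : ℤ → ℤ → ℝ) (x₁ : ℝ) (x₄ : OnePoint ℝ) : Prop :=
  (-1 ≤ x₁ ∧ x₁ < 1) ∧
  ((x₄ = ∞ ∧ ∃ c : ℝ, c ≠ 0 ∧ kernelDisc p = C c * (X - 1) ^ 2 * (X - C x₁)) ∨
    ∃ r : ℝ, x₄ = (r : OnePoint ℝ) ∧ (1 < r ∨ r ≤ -1) ∧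
      ∃ c : ℝ, c ≠ 0 ∧ kernelDisc p = C c * (X - 1) ^ 2 * (X - C x₁) * (X - C r))

end BranchPoints

/-- The principal complex square root. -/
def csqrt (z : ℂ) : ℂ := z ^ (1 / 2 : ℂ)

/-- The point `s₀`; its value at `x₄ = ∞` is the limit as `x₄ → ∞`. -/
def sZero (x₁ : ℝ) (x₄ : OnePoint ℝ) : ℂ :=
  x₄.elim (-1)
    (fun r => (2 - (x₁ + r) + 2 * csqrt ((1 - x₁) * (1 - r))) / (r - x₁))

/-- The point `s₁`; its value at `x₄ = ∞` is the limit as `x₄ → ∞` (up to the choice of the square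
root, which exchanges `s₁` and `1/s₁`). -/
def sOne (x₁ : ℝ) (x₄ : OnePoint ℝ) : ℂ :=
  x₄.elim (1 - 2 * x₁ + 2 * csqrt (-(x₁ * (1 - x₁))))
    (fun r => (x₁ + r - 2 * x₁ * r + 2 * csqrt (x₁ * r * (1 - x₁) * (1 - r))) / (r - x₁))

/-- `μ₀ = s₀ + 1/s₀`. -/
def muZero (x₁ : ℝ) (x₄ : OnePoint ℝ) : ℂ := sZero x₁ x₄ + 1 / sZero x₁ x₄

/-- `μ₁ = s₁ + 1/s₁`. -/
def muOne (x₁ : ℝ) (x₄ : OnePoint ℝ) : ℂ := sOne x₁ x₄ + 1 / sOne x₁ x₄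

/-- `μ(x) = (μ₀ x - μ₁) / (2 (x - 1))`. -/
def mu (x₁ : ℝ) (x₄ : OnePoint ℝ) (x : ℂ) : ℂ :=
  (muZero x₁ x₄ * x - muOne x₁ x₄) / (2 * (x - 1))

/-- `F` is the analytic continuation of the Gauss hypergeometric series `₂F₁(a, b; c; ·)` from the
unit disk to the cut plane `ℂ \ [1, ∞)`. By the identity theorem it is unique on the cut plane. -/
def IsGaussContinuation (a b c : ℂ) (F : ℂ → ℂ) : Prop :=
  DifferentiableOn ℂ F {z | ¬(z.im = 0 ∧ 1 ≤ z.re)} ∧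
    ∀ z ∈ Metric.ball (0 : ℂ) 1, F z = ordinaryHypergeometric a b c z

open Classical in
/-- The Gauss hypergeometric function `₂F₁(a, b; c; z)` on the cut plane `ℂ \ [1, ∞)`. -/
def gaussHypergeometric (a b c : ℂ) : ℂ → ℂ :=
  if h : ∃ F, IsGaussContinuation a b c F then h.choose else 0

/-- The generalized Chebyshev function `T_a(x) = ₂F₁(-a, a; 1/2; (1-x)/2)`, for
`x ∈ ℂ \ (-∞, -1]`. -/
def chebyshevT (a : ℝ) (x : ℂ) : ℂ :=
  gaussHypergeometric (-a) a (1 / 2) ((1 - x) / 2)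

end QuarterPlane

end

/-!
Zero drift makes `(1, 1)` a double point of the biquadratic kernel curve `K(x, y) = 0`. Sending this
point to infinity by `u = 1/(x-1)`, `v = 1/(y-1)` turns `K` into a polynomial of degree two, and an
affine map `u ↦ M - N u` brings the resulting conic into the form
`X² + Y² - 2 cos θ X Y = sin² θ`, which `X = cos φ`, `Y = cos (φ ± θ)` parametrizes. The points with
vertical tangent are `X = ±1`; they are the images of the branch points `x₁`, `x₄`, and this
identifies `X = M - N u` with `μ(x)` (`exists_mu_eq`).

If `K(x, y) = 0` and `|x| = |y|`, then `y = x̄`: the common factor `t` in `x = t w`, `y = t w̄` is a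
root of a real quartic that has only real roots (`eq_conj_of_kernel_eq_zero`). Hence the
curve `𝒮₁` is the part in the closed unit disk of the curve `K(x, x̄) = 0`. In the coordinate `X`
the latter is a hyperbola with foci `±1` and semi-axes `cos (θ/2)`, `sin (θ/2)`. The unit circle
becomes a vertical line that passes between the two branches, so `μ` maps `𝒮₁⁺` onto the interior of
the right branch (`mem_interiorS_iff`, `mu_mem_hyperbolaInterior_iff`).

The interior of the right branch is the image of the strip `|Re φ| < θ/2` under the cosine, and
`T_a (cos φ) = cos (a φ)` (`chebyshevT_spec`). For `a = π/θ` the function `T_a` therefore maps it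
bijectively onto the cosine image of the strip of half-width `π/2`, the right half-plane
(`chebyshevT_bijOn`). To identify the hypergeometric function, a holomorphic `T` with
`T (cos φ) = cos (a φ)` is constructed on the cut plane; it satisfies the Chebyshev differential
equation, whose derivatives at `1` give the recursion of the hypergeometric coefficients.

At the origin `μ(0)` is real and at least `cos (θ/2)`, with equality exactly if `p 1 1 = 0`, since
`K(0, 0) = - p 1 1`. The normalization follows from the values of `T_a` on the real axis
(`chebyshevT_real`).
-/

open scoped OnePoint

namespace QuarterPlane

/-! ### The generalized Chebyshev function through the cosine -/

/-- The plane cut along `(-∞, -1]`, the domain of the generalized Chebyshev functions. -/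
def chebyshevDomain : Set ℂ := {x | ¬(x.im = 0 ∧ x.re ≤ -1)}

lemma isOpen_chebyshevDomain : IsOpen chebyshevDomain := by
  have : chebyshevDomain = ({x : ℂ | x.im = 0} ∩ {x | x.re ≤ -1})ᶜ := rfl
  rw [this]
  exact ((isClosed_eq Complex.continuous_im continuous_const).inter
    (isClosed_le Complex.continuous_re continuous_const)).isOpen_compl

lemma isOpen_re_abs_lt (r : ℝ) : IsOpen {φ : ℂ | |φ.re| < r} :=
  isOpen_lt (Complex.continuous_re.abs) continuous_const

lemma cos_re_im (φ : ℂ) : (Complex.cos φ).re = Real.cos φ.re * Real.cosh φ.im ∧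
    (Complex.cos φ).im = -(Real.sin φ.re * Real.sinh φ.im) := by
  have := Complex.cos_eq φ
  constructor
  · rw [this]
    simp [← Complex.ofReal_cos, ← Complex.ofReal_sin, ← Complex.ofReal_cosh, ← Complex.ofReal_sinh]
  · rw [this]
    simp [← Complex.ofReal_cos, ← Complex.ofReal_sin, ← Complex.ofReal_cosh, ← Complex.ofReal_sinh]

/-- Every complex number is the cosine of a point of the closed strip `|Re φ| ≤ π`. -/
lemma exists_cos_eq_abs_re_le (x : ℂ) : ∃ φ : ℂ, |φ.re| ≤ Real.pi ∧ Complex.cos φ = x := by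
  obtain ⟨w, hw⟩ := Complex.cos_surjective x
  refine ⟨w - (round (w.re / (2 * Real.pi)) : ℤ) * (2 * Real.pi), ?_, ?_⟩
  · have h := abs_sub_round (w.re / (2 * Real.pi))
    have hpi := Real.pi_pos
    set k := round (w.re / (2 * Real.pi))
    have e : (w - (k : ℤ) * (2 * Real.pi)).re = (w.re / (2 * Real.pi) - k) * (2 * Real.pi) := by
      simp only [Complex.sub_re, Complex.mul_re, Complex.intCast_re, Complex.intCast_im,
        Complex.re_ofNat, Complex.im_ofNat, Complex.ofReal_re, Complex.ofReal_im]
      field_simp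
      ring
    rw [e, abs_mul, abs_of_pos (by positivity : 0 < 2 * Real.pi)]
    nlinarith
  · rw [Complex.cos_sub_int_mul_two_pi, hw]

lemma cos_mem_chebyshevDomain {φ : ℂ} (hφ : |φ.re| < Real.pi) :
    Complex.cos φ ∈ chebyshevDomain := by
  rintro ⟨h1, h2⟩
  rw [(cos_re_im φ).2] at h1
  rw [(cos_re_im φ).1] at h2
  have hφ' := abs_lt.1 hφ
  have hcosh := Real.one_le_cosh φ.im
  have hcos : -1 < Real.cos φ.re := by
    rw [← Real.cos_abs, ← Real.cos_pi]
    exact Real.cos_lt_cos_of_nonneg_of_le_pi (abs_nonneg _) le_rfl hφ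
  rcases mul_eq_zero.1 (neg_eq_zero.1 h1) with h | h
  · have h0 := (Real.sin_eq_zero_iff_of_lt_of_lt hφ'.1 hφ'.2).1 h
    rw [h0, Real.cos_zero] at h2
    linarith
  · rw [Real.sinh_eq_zero] at h
    rw [h, Real.cosh_zero] at h2
    linarith

lemma exists_cos_eq_of_mem_chebyshevDomain {x : ℂ} (hx : x ∈ chebyshevDomain) :
    ∃ φ : ℂ, |φ.re| < Real.pi ∧ Complex.cos φ = x := by
  obtain ⟨φ, h1, h2⟩ := exists_cos_eq_abs_re_le x
  refine ⟨φ, lt_of_le_of_ne h1 fun h => hx ?_, h2⟩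
  have hs : Real.sin φ.re = 0 := by
    have : |Real.sin φ.re| = 0 := by
      rcases abs_choice φ.re with h' | h'
      · rw [h'] at h; rw [h, Real.sin_pi, abs_zero]
      · rw [h'] at h; rw [← abs_neg, ← Real.sin_neg, h, Real.sin_pi, abs_zero]
    exact abs_eq_zero.1 this
  have hc : Real.cos φ.re = -1 := by rw [← Real.cos_abs, h, Real.cos_pi]
  have := Real.one_le_cosh φ.im
  rw [← h2, (cos_re_im φ).1, (cos_re_im φ).2, hs, hc]
  constructor
  · simp
  · linarith

/-- On the strip `|Re φ| < π` the cosine identifies only opposite points. -/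
lemma eq_or_eq_neg_of_cos_eq {φ χ : ℂ} (hφ : |φ.re| < Real.pi) (hχ : |χ.re| < Real.pi)
    (h : Complex.cos φ = Complex.cos χ) : χ = φ ∨ χ = -φ := by
  obtain ⟨k, hk⟩ := Complex.cos_eq_cos_iff.1 h
  have hpi := Real.pi_pos
  rw [abs_lt] at hφ hχ
  have key : (k : ℝ) * (2 * Real.pi) < 2 * Real.pi ∧ -(2 * Real.pi) < k * (2 * Real.pi) := by
    rcases hk with hk | hk
    all_goals
      have := congrArg Complex.re hk
      simp at this
      constructor <;> nlinarith
  have k1 : (k : ℝ) < 1 := by nlinarith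
  have k2 : (-1 : ℝ) < k := by nlinarith
  have k1' : k < 1 := by exact_mod_cast k1
  have k2' : -1 < k := by exact_mod_cast k2
  have k0 : k = 0 := by omega
  subst k0
  simpa using hk

lemma cos_mul_eq_of_cos_eq (a : ℂ) {φ χ : ℂ} (hφ : |φ.re| < Real.pi) (hχ : |χ.re| < Real.pi)
    (h : Complex.cos φ = Complex.cos χ) : Complex.cos (a * φ) = Complex.cos (a * χ) := by
  rcases eq_or_eq_neg_of_cos_eq hφ hχ h with rfl | rfl
  · rfl
  · rw [mul_neg, Complex.cos_neg]

lemma sin_ne_zero_of_abs_re_lt {φ : ℂ} (hφ : |φ.re| < Real.pi) (h0 : φ ≠ 0) :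
    Complex.sin φ ≠ 0 := by
  intro h
  obtain ⟨k, hk⟩ := Complex.sin_eq_zero_iff.1 h
  have hpi := Real.pi_pos
  have hre : φ.re = k * Real.pi := by rw [hk]; simp
  rw [hre, abs_mul, abs_of_pos hpi] at hφ
  have k1 : |(k : ℝ)| < 1 := by nlinarith
  have k2 : |k| < 1 := by exact_mod_cast k1
  rw [Int.abs_lt_one_iff] at k2
  apply h0
  rw [hk, k2]
  simp

/-- There is a holomorphic `T` on the cut plane with `T (cos φ) = cos (a φ)` on `|Re φ| < π`: away
from `1` it is `cos (a ·)` composed with a local inverse of the cosine, and the singularity at `1`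
is removable because the cosine is open. -/
lemma exists_differentiableOn_cos_mul (a : ℂ) : ∃ T : ℂ → ℂ,
    DifferentiableOn ℂ T chebyshevDomain ∧
    ∀ φ : ℂ, |φ.re| < Real.pi → T (Complex.cos φ) = Complex.cos (a * φ) := by
  classical
  choose! g hg1 hg2 using fun (x : ℂ) (hx : x ∈ chebyshevDomain) =>
    exists_cos_eq_of_mem_chebyshevDomain hx
  have hT : ∀ φ : ℂ, |φ.re| < Real.pi →
      Complex.cos (a * g (Complex.cos φ)) = Complex.cos (a * φ) := fun φ hφ =>
    cos_mul_eq_of_cos_eq a (hg1 _ (cos_mem_chebyshevDomain hφ)) hφ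
      (hg2 _ (cos_mem_chebyshevDomain hφ))
  refine ⟨fun x => Complex.cos (a * g x), ?_, hT⟩
  have h1mem : (1 : ℂ) ∈ chebyshevDomain := by
    rintro ⟨-, h⟩
    norm_num at h
  have hpi := Real.pi_pos
  rw [← Complex.differentiableOn_compl_singleton_and_continuousAt_iff
    (isOpen_chebyshevDomain.mem_nhds h1mem)]
  constructor
  · rintro x ⟨hx, hx1⟩
    apply DifferentiableAt.differentiableWithinAt
    set φ := g x with hφdef
    have hφ : |φ.re| < Real.pi := hg1 x hx
    have hcx : Complex.cos φ = x := hg2 x hx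
    have hφ0 : φ ≠ 0 := by
      intro h
      apply hx1
      rw [Set.mem_singleton_iff, ← hcx, h, Complex.cos_zero]
    have hs : -Complex.sin φ ≠ 0 := neg_ne_zero.2 (sin_ne_zero_of_abs_re_lt hφ hφ0)
    have hd := Complex.hasStrictDerivAt_cos φ
    have hinv := hd.to_localInverse hs
    have hli := hd.eventually_left_inverse hs
    have hri := hd.eventually_right_inverse hs
    rw [hcx] at hinv hri
    set l := hd.localInverse Complex.cos (-Complex.sin φ) φ hs
    have hlx : l x = φ := by rw [← hcx]; exact hli.self_of_nhds
    have hstrip : ∀ᶠ y in nhds x, |(l y).re| < Real.pi :=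
      hinv.hasDerivAt.continuousAt.eventually
        ((isOpen_re_abs_lt Real.pi).mem_nhds (by rw [hlx]; exact hφ))
    have hev : (fun y => Complex.cos (a * g y)) =ᶠ[nhds x] fun y => Complex.cos (a * l y) := by
      filter_upwards [hstrip, hri] with y hy1 hy2
      rw [← hT (l y) hy1, hy2]
    exact DifferentiableAt.congr_of_eventuallyEq
      ((hinv.hasDerivAt.differentiableAt.const_mul a).ccos) hev
  · have hopen : nhds (Complex.cos 0) ≤ Filter.map Complex.cos (nhds 0) := by
      rcases (Complex.differentiable_cos.analyticAt 0).eventually_constant_or_nhds_le_map_nhds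
        with h | h
      · exfalso
        have h' : Complex.cos =ᶠ[nhds 0] fun _ => Complex.cos 0 := h
        have hd : deriv Complex.cos =ᶠ[nhds 0] deriv fun _ : ℂ => Complex.cos 0 := h'.deriv
        have := hd.deriv_eq
        simp at this
      · exact h
    have hlim : Filter.Tendsto (fun φ => Complex.cos (a * g (Complex.cos φ))) (nhds 0)
        (nhds (Complex.cos (a * 0))) := by
      have hc : Filter.Tendsto (fun φ => Complex.cos (a * φ)) (nhds 0)
          (nhds (Complex.cos (a * 0))) := by
        apply Continuous.tendsto
        fun_prop
      refine hc.congr' ?_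
      filter_upwards [(isOpen_re_abs_lt Real.pi).mem_nhds
        (show (0 : ℂ) ∈ {φ : ℂ | |φ.re| < Real.pi} by simpa using hpi)] with φ hφ
      exact (hT φ hφ).symm
    have h1 := hT 0 (by simpa using hpi)
    rw [Complex.cos_zero] at hopen h1
    rw [ContinuousAt, h1]
    exact (Filter.tendsto_map'_iff.2 hlim).mono_left hopen

/-! ### The Chebyshev equation and the hypergeometric series -/

section ChebyshevODE

variable {a : ℂ} {T : ℂ → ℂ} (hT : DifferentiableOn ℂ T chebyshevDomain)
  (hcos : ∀ φ : ℂ, |φ.re| < Real.pi → T (Complex.cos φ) = Complex.cos (a * φ))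
include hT hcos

lemma deriv_cos_mul_sin {φ : ℂ} (hφ : |φ.re| < Real.pi) :
    deriv T (Complex.cos φ) * Complex.sin φ = a * Complex.sin (a * φ) := by
  have hTd : HasDerivAt T (deriv T (Complex.cos φ)) (Complex.cos φ) :=
    (hT.differentiableAt
      (isOpen_chebyshevDomain.mem_nhds (cos_mem_chebyshevDomain hφ))).hasDerivAt
  have h1 := hTd.comp φ (Complex.hasDerivAt_cos φ)
  have h2 : HasDerivAt (fun φ => Complex.cos (a * φ)) (-Complex.sin (a * φ) * (a * 1)) φ :=
    ((hasDerivAt_id φ).const_mul a).ccos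
  have hev : (T ∘ Complex.cos) =ᶠ[nhds φ] fun φ => Complex.cos (a * φ) := by
    filter_upwards [(isOpen_re_abs_lt Real.pi).mem_nhds hφ] with χ hχ
    exact hcos χ hχ
  have := h1.unique (h2.congr_of_eventuallyEq hev)
  linear_combination -this

/-- The Chebyshev differential equation, obtained by differentiating `T (cos φ) = cos (a φ)`
twice. -/
lemma chebyshev_ode {x : ℂ} (hx : x ∈ chebyshevDomain) :
    (1 - x ^ 2) * deriv (deriv T) x - x * deriv T x + a ^ 2 * T x = 0 := by
  obtain ⟨φ, hφ, rfl⟩ := exists_cos_eq_of_mem_chebyshevDomain hx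
  have hd : HasDerivAt (deriv T) (deriv (deriv T) (Complex.cos φ)) (Complex.cos φ) :=
    ((hT.deriv isOpen_chebyshevDomain).differentiableAt
      (isOpen_chebyshevDomain.mem_nhds hx)).hasDerivAt
  have h1 := (hd.comp φ (Complex.hasDerivAt_cos φ)).mul (Complex.hasDerivAt_sin φ)
  have h2 : HasDerivAt (fun φ => a * Complex.sin (a * φ))
      (a * (Complex.cos (a * φ) * (a * 1))) φ :=
    (((hasDerivAt_id φ).const_mul a).csin).const_mul a
  have hev : ((deriv T ∘ Complex.cos) * Complex.sin) =ᶠ[nhds φ]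
      fun φ => a * Complex.sin (a * φ) := by
    filter_upwards [(isOpen_re_abs_lt Real.pi).mem_nhds hφ] with χ hχ
    exact deriv_cos_mul_sin hT hcos hχ
  have h3 := h1.unique (h2.congr_of_eventuallyEq hev)
  rw [hcos φ hφ]
  have h4 := Complex.sin_sq_add_cos_sq φ
  simp only [Function.comp_apply] at h3
  linear_combination -h3 - deriv (deriv T) (Complex.cos φ) * h4

/-- The `n`-fold derivative of the Chebyshev equation; at `x = 1` the leading term drops out and a
two-term recursion for the derivatives of `T` remains. -/
lemma chebyshev_ode_iteratedDeriv (n : ℕ) : ∀ x ∈ chebyshevDomain,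
    (1 - x ^ 2) * iteratedDeriv (n + 2) T x - (2 * n + 1) * x * iteratedDeriv (n + 1) T x
      + (a ^ 2 - n ^ 2) * iteratedDeriv n T x = 0 := by
  have hdiff : ∀ n : ℕ, DifferentiableOn ℂ (iteratedDeriv n T) chebyshevDomain := by
    intro n
    induction n with
    | zero => simpa using hT
    | succ n ih => rw [iteratedDeriv_succ]; exact ih.deriv isOpen_chebyshevDomain
  have hder : ∀ (n : ℕ), ∀ x ∈ chebyshevDomain,
      HasDerivAt (iteratedDeriv n T) (iteratedDeriv (n + 1) T x) x := by
    intro n x hx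
    rw [iteratedDeriv_succ]
    exact ((hdiff n).differentiableAt (isOpen_chebyshevDomain.mem_nhds hx)).hasDerivAt
  induction n with
  | zero =>
    intro x hx
    have := chebyshev_ode hT hcos hx
    simp only [iteratedDeriv_succ, iteratedDeriv_zero]
    push_cast
    linear_combination this
  | succ n ih =>
    intro x hx
    have hA := ((hasDerivAt_const x (1 : ℂ)).sub (hasDerivAt_pow 2 x)).mul (hder (n + 2) x hx)
    have hB := (((hasDerivAt_id x).const_mul (2 * n + 1 : ℂ))).mul (hder (n + 1) x hx)
    have hC := (hder n x hx).const_mul (a ^ 2 - n ^ 2)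
    have h1 := (hA.sub hB).add hC
    have h2 : HasDerivAt (fun _ : ℂ => (0 : ℂ)) 0 x := hasDerivAt_const x 0
    have h3 := h1.unique (h2.congr_of_eventuallyEq (by
      filter_upwards [isOpen_chebyshevDomain.mem_nhds hx] with y hy
      simpa using ih y hy))
    simp only [Pi.sub_apply, id_eq] at h3
    push_cast
    linear_combination h3

lemma iteratedDeriv_one_eq_ascPochhammer (n : ℕ) :
    (-2) ^ n * iteratedDeriv n T 1 = (ascPochhammer ℂ n).eval (-a) * (ascPochhammer ℂ n).eval a *
      ((ascPochhammer ℂ n).eval (1 / 2))⁻¹ := by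
  have h1mem : (1 : ℂ) ∈ chebyshevDomain := by
    rintro ⟨-, h⟩
    norm_num at h
  induction n with
  | zero =>
    have := hcos 0 (by simpa using Real.pi_pos)
    simpa using this
  | succ n ih =>
    have hode := chebyshev_ode_iteratedDeriv hT hcos n 1 h1mem
    have hn : (2 * n + 1 : ℂ) ≠ 0 := by exact_mod_cast (by omega : 2 * n + 1 ≠ 0)
    have hstep : iteratedDeriv (n + 1) T 1 =
        (a ^ 2 - n ^ 2) * iteratedDeriv n T 1 / (2 * n + 1) := by
      rw [eq_div_iff hn]
      linear_combination -hode
    have hhalf : (1 / 2 + n : ℂ)⁻¹ = 2 / (2 * n + 1) := by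
      rw [inv_eq_iff_eq_inv, inv_div]
      ring
    rw [ascPochhammer_succ_eval, ascPochhammer_succ_eval, ascPochhammer_succ_eval, mul_inv, hhalf,
      hstep]
    linear_combination (2 * (n ^ 2 - a ^ 2) / (2 * n + 1)) * ih

/-- Comparison of Taylor coefficients at `1`: by the differentiated Chebyshev equation they obey
the recursion of the hypergeometric coefficients. -/
lemma eq_ordinaryHypergeometric {z : ℂ} (hz : z ∈ Metric.ball (0 : ℂ) 1) :
    T (1 - 2 * z) = ordinaryHypergeometric (-a) a (1 / 2 : ℂ) z := by
  have hsub : Metric.ball (1 : ℂ) 2 ⊆ chebyshevDomain := by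
    rintro x hx ⟨-, h2⟩
    rw [mem_ball_iff_norm] at hx
    have := (Complex.abs_re_le_norm (x - 1)).trans_lt hx
    rw [abs_lt] at this
    simp at this
    linarith
  have hz' : 1 - 2 * z ∈ Metric.ball (1 : ℂ) 2 := by
    rw [mem_ball_zero_iff] at hz
    rw [mem_ball_iff_norm]
    simp
    linarith
  have h := Complex.taylorSeries_eq_on_ball' hz' (hT.mono hsub)
  rw [← h, ordinaryHypergeometric_eq_tsum]
  refine tsum_congr fun n => ?_
  have hn := iteratedDeriv_one_eq_ascPochhammer hT hcos n
  rw [smul_eq_mul, show (1 - 2 * z - 1 : ℂ) = -2 * z by ring, mul_pow]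
  linear_combination ((n.factorial : ℂ)⁻¹ * z ^ n) * hn

end ChebyshevODE

/-- The analytic continuation of `₂F₁(-a, a; 1/2; ·)` exists, and it is
`cos (a φ)` at `(1 - cos φ) / 2`. -/
theorem chebyshevT_spec (a : ℝ) : DifferentiableOn ℂ (chebyshevT a) chebyshevDomain ∧
    ∀ φ : ℂ, |φ.re| < Real.pi → chebyshevT a (Complex.cos φ) = Complex.cos (a * φ) := by
  obtain ⟨T, hT, hcos⟩ := exists_differentiableOn_cos_mul (a : ℂ)
  have hmaps : Set.MapsTo (fun z : ℂ => 1 - 2 * z) {z : ℂ | ¬(z.im = 0 ∧ 1 ≤ z.re)}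
      chebyshevDomain := by
    rintro z hz ⟨h1, h2⟩
    apply hz
    simp at h1 h2
    exact ⟨h1, by linarith⟩
  have hmaps' : ∀ x ∈ chebyshevDomain, (1 - x) / 2 ∈ {z : ℂ | ¬(z.im = 0 ∧ 1 ≤ z.re)} := by
    rintro x hx ⟨h1, h2⟩
    apply hx
    simp at h1 h2
    exact ⟨h1, by linarith⟩
  have hex : IsGaussContinuation (-(a : ℂ)) a (1 / 2) (fun z => T (1 - 2 * z)) := by
    refine ⟨?_, fun z hz => eq_ordinaryHypergeometric hT hcos hz⟩
    exact hT.comp (by fun_prop) hmaps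
  have hopen : IsOpen {z : ℂ | ¬(z.im = 0 ∧ 1 ≤ z.re)} := by
    have : {z : ℂ | ¬(z.im = 0 ∧ 1 ≤ z.re)} = ({x : ℂ | x.im = 0} ∩ {x | 1 ≤ x.re})ᶜ := rfl
    rw [this]
    exact ((isClosed_eq Complex.continuous_im continuous_const).inter
      (isClosed_le continuous_const Complex.continuous_re)).isOpen_compl
  have hconn : IsPreconnected {z : ℂ | ¬(z.im = 0 ∧ 1 ≤ z.re)} := by
    have hstar : StarConvex ℝ (0 : ℂ) {z : ℂ | ¬(z.im = 0 ∧ 1 ≤ z.re)} := by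
      rw [starConvex_zero_iff]
      rintro z hz t ht0 ht1 ⟨h1, h2⟩
      simp at h1 h2
      rcases h1 with rfl | h1
      · norm_num at h2
      · refine hz ⟨h1, ?_⟩
        by_contra hlt
        rcases lt_or_ge z.re 0 with h0 | h0 <;> nlinarith
    exact (hstar.isPathConnected (by norm_num)).isConnected.isPreconnected
  have hG : gaussHypergeometric (-(a : ℂ)) a (1 / 2) = Exists.choose ⟨_, hex⟩ := by
    rw [gaussHypergeometric, dif_pos ⟨_, hex⟩]
  have hGc : IsGaussContinuation (-(a : ℂ)) a (1 / 2)
      (gaussHypergeometric (-(a : ℂ)) a (1 / 2)) := by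
    rw [hG]
    exact Exists.choose_spec (p := fun F => IsGaussContinuation (-(a : ℂ)) a (1 / 2) F) _
  have heq : Set.EqOn (gaussHypergeometric (-(a : ℂ)) a (1 / 2)) (fun z => T (1 - 2 * z))
      {z : ℂ | ¬(z.im = 0 ∧ 1 ≤ z.re)} := by
    refine (hGc.1.analyticOnNhd hopen).eqOn_of_preconnected_of_eventuallyEq
      (hex.1.analyticOnNhd hopen) hconn (z₀ := 0) (by simp) ?_
    filter_upwards [Metric.ball_mem_nhds (0 : ℂ) one_pos] with z hz
    exact (hGc.2 z hz).trans (hex.2 z hz).symm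
  have heqT : Set.EqOn (chebyshevT a) T chebyshevDomain := by
    intro x hx
    rw [chebyshevT, heq (hmaps' x hx)]
    change T (1 - 2 * ((1 - x) / 2)) = T x
    rw [show 1 - 2 * ((1 - x) / 2) = x by ring]
  exact ⟨hT.congr heqT, fun φ hφ => by rw [heqT (cos_mem_chebyshevDomain hφ), hcos φ hφ]⟩

/-! ### Conformal mapping of the interior of a hyperbola branch -/

/-- The convex domain bounded by the right branch of the hyperbola with foci `±1` and
semi-axes `cos (θ/2)` and `sin (θ/2)`. -/
def hyperbolaInterior (θ : ℝ) : Set ℂ :=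
  {x | 0 < x.re ∧ Real.cos (θ / 2) ^ 2 * Real.sin (θ / 2) ^ 2 <
    x.re ^ 2 * Real.sin (θ / 2) ^ 2 - x.im ^ 2 * Real.cos (θ / 2) ^ 2}

lemma cos_pos_of_abs_lt {t r : ℝ} (h : |t| < r) (hr : r ≤ Real.pi / 2) : 0 < Real.cos t := by
  rw [abs_lt] at h
  exact Real.cos_pos_of_mem_Ioo ⟨by linarith, by linarith⟩

/-- The cosine maps the strip `|Re φ| < θ/2` onto the interior of the hyperbola branch. -/
lemma mem_hyperbolaInterior_iff {θ : ℝ} (h0 : 0 < θ) (hpi : θ < Real.pi) {x : ℂ} :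
    x ∈ hyperbolaInterior θ ↔ ∃ φ : ℂ, |φ.re| < θ / 2 ∧ Complex.cos φ = x := by
  have hc0 : 0 < Real.cos (θ / 2) := Real.cos_pos_of_mem_Ioo ⟨by linarith, by linarith⟩
  have hs0 : 0 < Real.sin (θ / 2) := Real.sin_pos_of_pos_of_lt_pi (by linarith) (by linarith)
  have hcs := Real.sin_sq_add_cos_sq (θ / 2)
  -- the defining inequality in the coordinates of the strip
  have key : ∀ φ : ℂ, (Complex.cos φ).re ^ 2 * Real.sin (θ / 2) ^ 2 -
      (Complex.cos φ).im ^ 2 * Real.cos (θ / 2) ^ 2 -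
      Real.cos (θ / 2) ^ 2 * Real.sin (θ / 2) ^ 2 =
      (Real.cos φ.re ^ 2 - Real.cos (θ / 2) ^ 2) *
        (Real.cosh φ.im ^ 2 - Real.cos (θ / 2) ^ 2) := by
    intro φ
    rw [(cos_re_im φ).1, (cos_re_im φ).2, neg_sq, mul_pow, mul_pow, Real.sinh_sq, Real.sin_sq,
      Real.sin_sq]
    ring
  have hch : ∀ φ : ℂ, 0 < Real.cosh φ.im ^ 2 - Real.cos (θ / 2) ^ 2 := by
    intro φ
    have := Real.one_le_cosh φ.im
    nlinarith [sq_pos_of_pos hs0]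
  constructor
  · rintro ⟨h1, h2⟩
    obtain ⟨φ, hφ, rfl⟩ := exists_cos_eq_abs_re_le x
    refine ⟨φ, ?_, rfl⟩
    have h3 := key φ
    have h4 : 0 < Real.cos φ.re ^ 2 - Real.cos (θ / 2) ^ 2 := by
      by_contra hle
      have := mul_nonpos_of_nonpos_of_nonneg (not_lt.1 hle) (hch φ).le
      linarith
    rw [(cos_re_im φ).1] at h1
    have h5 : 0 < Real.cos φ.re := (pos_iff_pos_of_mul_pos h1).2 (Real.cosh_pos _)
    have h6 : Real.cos (θ / 2) < Real.cos |φ.re| := by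
      rw [Real.cos_abs]
      exact lt_of_pow_lt_pow_left₀ 2 h5.le (by linarith)
    by_contra hge
    exact absurd (Real.cos_le_cos_of_nonneg_of_le_pi (by linarith) hφ (not_lt.1 hge))
      (not_le.2 h6)
  · rintro ⟨φ, hφ, rfl⟩
    have h5 : 0 < Real.cos φ.re := cos_pos_of_abs_lt hφ (by linarith)
    have h6 : Real.cos (θ / 2) < Real.cos φ.re := by
      rw [← Real.cos_abs φ.re]
      exact Real.cos_lt_cos_of_nonneg_of_le_pi (abs_nonneg _) (by linarith) hφ
    refine ⟨?_, ?_⟩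
    · rw [(cos_re_im φ).1]
      exact mul_pos h5 (Real.cosh_pos _)
    · have h3 := key φ
      have := mul_pos (show 0 < Real.cos φ.re ^ 2 - Real.cos (θ / 2) ^ 2 by nlinarith) (hch φ)
      linarith

lemma hyperbolaInterior_subset_chebyshevDomain (θ : ℝ) :
    hyperbolaInterior θ ⊆ chebyshevDomain := by
  rintro x ⟨h, -⟩ ⟨-, h2⟩
  linarith

/-- `cos φ ↦ cos (π φ / θ)` turns the strip `|Re φ| < θ/2`, modulo sign, into the strip of
half-width `π/2`, which the cosine maps onto the right half-plane. -/
lemma chebyshevT_bijOn {θ : ℝ} (h0 : 0 < θ) (hpi : θ < Real.pi) :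
    Set.BijOn (chebyshevT (Real.pi / θ)) (hyperbolaInterior θ) rightHalfPlane := by
  have hpos := Real.pi_pos
  have hT := (chebyshevT_spec (Real.pi / θ)).2
  have hscale : ∀ φ : ℂ, |φ.re| < θ / 2 →
      |(((Real.pi / θ : ℝ) : ℂ) * φ).re| < Real.pi / 2 := by
    intro φ hφ
    rw [Complex.re_ofReal_mul, abs_mul, abs_of_pos (by positivity)]
    calc Real.pi / θ * |φ.re| < Real.pi / θ * (θ / 2) := by gcongr
      _ = Real.pi / 2 := by field_simp
  refine ⟨?_, ?_, ?_⟩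
  · intro x hx
    obtain ⟨φ, hφ, rfl⟩ := (mem_hyperbolaInterior_iff h0 hpi).1 hx
    rw [hT φ (by linarith), rightHalfPlane, Set.mem_ofPred_eq, (cos_re_im _).1]
    exact mul_pos (cos_pos_of_abs_lt (hscale φ hφ) le_rfl) (Real.cosh_pos _)
  · intro x hx y hy hxy
    obtain ⟨φ, hφ, rfl⟩ := (mem_hyperbolaInterior_iff h0 hpi).1 hx
    obtain ⟨χ, hχ, rfl⟩ := (mem_hyperbolaInterior_iff h0 hpi).1 hy
    rw [hT φ (by linarith), hT χ (by linarith)] at hxy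
    have ha : ((Real.pi / θ : ℝ) : ℂ) ≠ 0 := by
      rw [Complex.ofReal_ne_zero]
      positivity
    rcases eq_or_eq_neg_of_cos_eq (by linarith [hscale φ hφ]) (by linarith [hscale χ hχ]) hxy
      with h | h
    · rw [mul_left_cancel₀ ha h]
    · rw [← mul_neg] at h
      rw [mul_left_cancel₀ ha h, Complex.cos_neg]
  · intro w hw
    obtain ⟨χ, hχ, rfl⟩ := exists_cos_eq_abs_re_le w
    rw [rightHalfPlane, Set.mem_ofPred_eq, (cos_re_im _).1] at hw
    have h5 : 0 < Real.cos χ.re := (pos_iff_pos_of_mul_pos hw).2 (Real.cosh_pos _)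
    have hlt : |χ.re| < Real.pi / 2 := by
      by_contra hge
      rw [← Real.cos_abs] at h5
      exact absurd (Real.cos_nonpos_of_pi_div_two_le_of_le (not_lt.1 hge) (by linarith))
        (not_le.2 h5)
    have hre : |(((θ / Real.pi : ℝ) : ℂ) * χ).re| < θ / 2 := by
      rw [Complex.re_ofReal_mul, abs_mul, abs_of_pos (by positivity)]
      calc θ / Real.pi * |χ.re| < θ / Real.pi * (Real.pi / 2) := by gcongr
        _ = θ / 2 := by field_simp
    refine ⟨Complex.cos ((θ / Real.pi : ℝ) * χ),
      (mem_hyperbolaInterior_iff h0 hpi).2 ⟨_, hre, rfl⟩, ?_⟩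
    rw [hT _ (by linarith), ← mul_assoc, ← Complex.ofReal_mul]
    rw [show Real.pi / θ * (θ / Real.pi) = 1 by field_simp]
    simp

/-! ### Generalized Chebyshev functions on the real axis -/

lemma hasDerivAt_chebyshevT (a : ℝ) {x : ℂ} (hx : x ∈ chebyshevDomain) :
    HasDerivAt (chebyshevT a) (deriv (chebyshevT a) x) x :=
  ((chebyshevT_spec a).1.differentiableAt (isOpen_chebyshevDomain.mem_nhds hx)).hasDerivAt

/-- On the part `x ≥ cos (θ/2)` of the real axis the function `T_{π/θ}` is real with positive
derivative; it vanishes at the vertex `cos (θ/2)` only. The three cases are `x = cos t`, `x = 1`,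
where the Chebyshev equation yields the derivative, and `x = cosh t`. -/
lemma chebyshevT_real {θ : ℝ} (h0 : 0 < θ) (hpi : θ < Real.pi) {x : ℝ}
    (hx : Real.cos (θ / 2) ≤ x) :
    (∃ d : ℝ, 0 < d ∧ HasDerivAt (chebyshevT (Real.pi / θ)) d x) ∧
    (x = Real.cos (θ / 2) → chebyshevT (Real.pi / θ) x = 0) ∧
    (Real.cos (θ / 2) < x → ∃ t : ℝ, 0 < t ∧ chebyshevT (Real.pi / θ) x = t) := by
  have hpos := Real.pi_pos
  have hapos : 0 < Real.pi / θ := by positivity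
  have hc0 : 0 < Real.cos (θ / 2) := Real.cos_pos_of_mem_Ioo ⟨by linarith, by linarith⟩
  have hdom : (x : ℂ) ∈ chebyshevDomain := by
    rintro ⟨-, h⟩
    rw [Complex.ofReal_re] at h
    linarith
  obtain ⟨hTd, hT⟩ := chebyshevT_spec (Real.pi / θ)
  have hmul := fun φ hφ => deriv_cos_mul_sin hTd hT (φ := φ) hφ
  have hder := hasDerivAt_chebyshevT (Real.pi / θ) hdom
  rcases lt_trichotomy x 1 with h1 | rfl | h1
  · obtain ⟨t, ht0, htθ, rfl⟩ : ∃ t : ℝ, 0 < t ∧ t ≤ θ / 2 ∧ Real.cos t = x := by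
      refine ⟨Real.arccos x, Real.arccos_pos.2 h1, ?_, Real.cos_arccos (by linarith) h1.le⟩
      rw [← Real.arccos_cos (by linarith : 0 ≤ θ / 2) (by linarith)]
      exact Real.arccos_le_arccos hx
    have hre : |(t : ℂ).re| < Real.pi := by
      rw [Complex.ofReal_re, abs_of_pos ht0]
      linarith
    have hsin : 0 < Real.sin t := Real.sin_pos_of_pos_of_lt_pi ht0 (by linarith)
    have hat : Real.pi / θ * t ≤ Real.pi / 2 := by
      calc Real.pi / θ * t ≤ Real.pi / θ * (θ / 2) := by gcongr
        _ = Real.pi / 2 := by field_simp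
    have hsin' : 0 < Real.sin (Real.pi / θ * t) :=
      Real.sin_pos_of_pos_of_lt_pi (by positivity) (by linarith)
    have hval : chebyshevT (Real.pi / θ) (Real.cos t : ℝ) = (Real.cos (Real.pi / θ * t) : ℝ) := by
      rw [Complex.ofReal_cos, hT _ hre, ← Complex.ofReal_mul, ← Complex.ofReal_cos]
    refine ⟨⟨Real.pi / θ * Real.sin (Real.pi / θ * t) / Real.sin t, by positivity, ?_⟩, ?_, ?_⟩
    · convert hder using 1
      have := hmul t hre
      push_cast
      rw [div_eq_iff (by rw [← Complex.ofReal_sin]; exact_mod_cast hsin.ne'), this]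
      push_cast
      rfl
    · intro h
      have : t = θ / 2 := Real.injOn_cos ⟨ht0.le, by linarith⟩ ⟨by linarith, by linarith⟩ h
      rw [hval, this, show Real.pi / θ * (θ / 2) = Real.pi / 2 by field_simp, Real.cos_pi_div_two,
        Complex.ofReal_zero]
    · intro h
      refine ⟨_, ?_, hval⟩
      have : t < θ / 2 := lt_of_le_of_ne htθ fun h' => by rw [h'] at h; exact lt_irrefl _ h
      apply Real.cos_pos_of_mem_Ioo
      constructor
      · have : 0 < Real.pi / θ * t := by positivity
        linarith
      · calc Real.pi / θ * t < Real.pi / θ * (θ / 2) := by gcongr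
          _ = Real.pi / 2 := by field_simp
  · have hlt : Real.cos (θ / 2) < 1 := by
      rw [← Real.cos_zero]
      exact Real.cos_lt_cos_of_nonneg_of_le_pi le_rfl (by linarith) (by linarith)
    have hval : chebyshevT (Real.pi / θ) ((1 : ℝ) : ℂ) = 1 := by
      have := hT 0 (by simpa using hpos)
      simpa using this
    refine ⟨⟨(Real.pi / θ) ^ 2, by positivity, ?_⟩, fun h => absurd h hlt.ne',
      fun _ => ⟨1, one_pos, by rw [hval]; simp⟩⟩
    convert hder using 1
    have hode := chebyshev_ode hTd hT hdom
    rw [hval] at hode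
    push_cast at hode ⊢
    linear_combination hode
  · obtain ⟨t, ht0, rfl⟩ : ∃ t : ℝ, 0 < t ∧ Real.cosh t = x :=
      ⟨Real.arcosh x, Real.arcosh_pos h1, Real.cosh_arcosh h1.le⟩
    have hre : |((t : ℂ) * Complex.I).re| < Real.pi := by simpa using hpos
    have hval : chebyshevT (Real.pi / θ) (Real.cosh t : ℝ) =
        (Real.cosh (Real.pi / θ * t) : ℝ) := by
      rw [Complex.ofReal_cosh, ← Complex.cos_mul_I, hT _ hre, ← mul_assoc, Complex.cos_mul_I,
        ← Complex.ofReal_mul, ← Complex.ofReal_cosh]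
    have hsinh : 0 < Real.sinh t := Real.sinh_pos_iff.2 ht0
    have hsinh' : 0 < Real.sinh (Real.pi / θ * t) := Real.sinh_pos_iff.2 (by positivity)
    refine ⟨⟨Real.pi / θ * Real.sinh (Real.pi / θ * t) / Real.sinh t, by positivity, ?_⟩, ?_,
      fun _ => ⟨_, Real.cosh_pos _, hval⟩⟩
    · convert hder using 1
      have := hmul _ hre
      rw [Complex.cos_mul_I, Complex.sin_mul_I,
        ← mul_assoc ((Real.pi / θ : ℝ) : ℂ) (t : ℂ) Complex.I, Complex.sin_mul_I,
        ← mul_assoc, ← mul_assoc] at this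
      have := mul_right_cancel₀ Complex.I_ne_zero this
      push_cast at this ⊢
      rw [div_eq_iff (by rw [← Complex.ofReal_sinh]; exact_mod_cast hsinh.ne'), this]
    · intro h
      have := Real.cos_le_one (θ / 2)
      linarith

/-! ### The kernel of a symmetric zero-drift walk -/

lemma stepSum_eq {E : Type*} [AddCommMonoid E] (f : ℤ → ℤ → E) :
    stepSum f = f (-1) (-1) + (f (-1) 0 + f (-1) 1) + ((f 0 (-1) + (f 0 0 + f 0 1)) +
      (f 1 (-1) + (f 1 0 + f 1 1))) := by
  have h : Finset.Icc (-1 : ℤ) 1 = {-1, 0, 1} := by decide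
  simp [stepSum, h, add_assoc]

variable {p : ℤ → ℤ → ℝ}

/-- The linear relations between the weights; `p 0 0` is eliminated. Irreducibility enters only as
positivity of `p 1 0 + p (-1) 0`: otherwise the steps preserve the parity of `k + l`, and
`x = y = -1` violates the condition on the characteristic function. -/
lemma IsSmallStepWalk.relations (hp : IsSmallStepWalk p) :
    p 0 1 = p 1 0 ∧ p (-1) 1 = p 1 (-1) ∧ p 0 (-1) = p (-1) 0 ∧
    p 1 1 + p 1 0 = p (-1) 0 + p (-1) (-1) ∧
    p 0 0 = 1 - (p 1 1 + 2 * p 1 0 + 2 * p 1 (-1) + 2 * p (-1) 0 + p (-1) (-1)) ∧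
    0 < p 1 0 + p (-1) 0 := by
  have h1 := hp.symm 0 1
  have h2 := hp.symm (-1) 1
  have h3 := hp.symm 0 (-1)
  have hd := hp.drift_fst
  have hs := hp.sum_eq_one
  rw [stepSum_eq] at hd hs
  push_cast at hd
  have h5 : p 0 0 = 1 - (p 1 1 + 2 * p 1 0 + 2 * p 1 (-1) + 2 * p (-1) 0 + p (-1) (-1)) := by
    rw [h1, h2, h3] at hs
    linarith
  refine ⟨h1, h2, h3, ?_, h5, ?_⟩
  · rw [h2] at hd
    linarith
  · have hb := hp.nonneg 1 0
    have hd' := hp.nonneg (-1) 0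
    rcases (add_nonneg hb hd').lt_or_eq with h | h
    · exact h
    · exfalso
      have hb0 : p 1 0 = 0 := by linarith
      have hd0 : p (-1) 0 = 0 := by linarith
      have := hp.irreducible (-1) (-1) (by simp) (by simp) (by
        rw [stepSum_eq, h1, h2, h3, hb0, hd0, h5, hb0, hd0]
        simp
        ring)
      have := congrArg Complex.re this.1
      norm_num at this

lemma IsSmallStepWalk.kernel_eq (hp : IsSmallStepWalk p) (x y : ℂ) :
    kernel p x y = x * y - (p 1 1 + p 1 0 * (x + y) + p 1 (-1) * (x ^ 2 + y ^ 2) + p 0 0 * (x * y)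
      + p (-1) 0 * (x * y) * (x + y) + p (-1) (-1) * (x * y) ^ 2) := by
  obtain ⟨h1, h2, h3, -⟩ := hp.relations
  have e2 : ∀ z : ℂ, z ^ (1 - -1 : ℤ) = z ^ 2 := fun z => by
    rw [show (1 - -1 : ℤ) = (2 : ℕ) by norm_num, zpow_natCast]
  rw [kernel, stepSum_eq, h1, h2, h3]
  simp only [e2, sub_zero, zpow_one, sub_self, zpow_zero]
  ring

/-- The difference `E k² - E kl` of the second moments of a step `(k, l)`, written as a
positive combination of the weights. -/
noncomputable def diffQuad (p : ℤ → ℤ → ℝ) : ℝ := p 1 0 + p (-1) 0 + 4 * p 1 (-1)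

/-- The sum `E k² + E kl` of the second moments, written as a positive combination of the
weights. -/
noncomputable def sumQuad (p : ℤ → ℤ → ℝ) : ℝ := 2 * p 1 1 + p 1 0 + p (-1) 0 + 2 * p (-1) (-1)

/-- Linear coefficient of the kernel in the coordinates `1/(x-1)`, `1/(y-1)`. -/
noncomputable def linCoeff (p : ℤ → ℤ → ℝ) : ℝ := p (-1) 0 + 2 * p (-1) (-1)

/-- The real function `K(x, x̄)`. -/
noncomputable def diagKernel (p : ℤ → ℤ → ℝ) (x : ℂ) : ℝ := (kernel p x (starRingEnd ℂ x)).re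

lemma IsSmallStepWalk.diagKernel_eq (hp : IsSmallStepWalk p) (x : ℂ) :
    diagKernel p x = (x.re ^ 2 + x.im ^ 2) - (p 1 1 + p 1 0 * (2 * x.re) +
      p 1 (-1) * (2 * (x.re ^ 2 - x.im ^ 2)) + p 0 0 * (x.re ^ 2 + x.im ^ 2) +
      p (-1) 0 * (x.re ^ 2 + x.im ^ 2) * (2 * x.re) +
      p (-1) (-1) * (x.re ^ 2 + x.im ^ 2) ^ 2) := by
  rw [diagKernel, hp.kernel_eq]
  simp [pow_two]
  ring

lemma IsSmallStepWalk.kernel_conj (hp : IsSmallStepWalk p) (x : ℂ) :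
    kernel p x (starRingEnd ℂ x) = diagKernel p x := by
  apply Complex.ext
  · rw [Complex.ofReal_re, diagKernel]
  · rw [Complex.ofReal_im, hp.kernel_eq]
    simp [pow_two]
    ring

/-- `K(x, x̄)` is positive on the unit circle apart from `x = 1`. -/
lemma IsSmallStepWalk.diagKernel_pos (hp : IsSmallStepWalk p) {x : ℂ} (hx : ‖x‖ = 1)
    (hx1 : x ≠ 1) : 0 < diagKernel p x := by
  obtain ⟨-, -, -, -, h5, h6⟩ := hp.relations
  have hn : x.re ^ 2 + x.im ^ 2 = 1 := by
    have := Complex.sq_norm x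
    rw [hx, Complex.normSq_apply] at this
    linarith
  have hre : x.re < 1 := by
    by_contra hle
    have h0 : x.im = 0 := by nlinarith [sq_nonneg x.im]
    have h1 : x.re = 1 := by nlinarith [sq_nonneg x.im]
    exact hx1 (Complex.ext (by simpa using h1) (by simpa using h0))
  have him := sq_nonneg x.im
  have hg := hp.nonneg 1 (-1)
  rw [hp.diagKernel_eq, hn, h5, show x.re ^ 2 - x.im ^ 2 = 1 - 2 * x.im ^ 2 by linarith]
  have := mul_pos h6 (sub_pos.2 hre)
  nlinarith [mul_nonneg hg him]

/-- A real quartic `-ε t⁴ - 2kδ t³ + m t² - 2kβ t - α` with `α, ε ≥ 0` that is nonnegative at `±1`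
has no nonreal root: a nonreal pair of roots would leave a quadratic quotient with nonpositive outer
coefficients and nonnegative values at `±1`, so that the quotient vanishes. -/
lemma quartic_root_im_eq_zero {α β δ ε k m : ℝ} (hα : 0 ≤ α) (hε : 0 ≤ ε)
    (h1 : 0 ≤ m - α - ε - 2 * k * (β + δ)) (h2 : 0 ≤ m - α - ε + 2 * k * (β + δ))
    (hm : 0 < m) {t : ℂ}
    (ht : (m : ℂ) * t ^ 2 = α + ε * t ^ 4 + 2 * k * (β * t + δ * t ^ 3)) : t.im = 0 := by
  by_contra hq
  have hre := congrArg Complex.re ht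
  have him := congrArg Complex.im ht
  simp only [pow_succ, pow_zero, one_mul, Complex.mul_re, Complex.mul_im, Complex.add_re,
    Complex.add_im, Complex.ofReal_re, Complex.ofReal_im, Complex.re_ofNat, Complex.im_ofNat]
    at hre him
  set a := t.re
  set b := t.im
  have hP : 0 < a ^ 2 + b ^ 2 := by positivity
  have hI : a * (ε * (a ^ 2 + b ^ 2) ^ 2 - α) +
      k * (a ^ 2 + b ^ 2) * (δ * (a ^ 2 + b ^ 2) - β) = 0 := by
    have : 2 * b * (a * (ε * (a ^ 2 + b ^ 2) ^ 2 - α) +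
      k * (a ^ 2 + b ^ 2) * (δ * (a ^ 2 + b ^ 2) - β)) = 0 := by
      linear_combination 2 * a * b * hre - (a ^ 2 - b ^ 2) * him
    exact (mul_eq_zero.1 this).resolve_left (by simpa using hq)
  have hR : m * (a ^ 2 + b ^ 2) ^ 2 = (α + ε * (a ^ 2 + b ^ 2) ^ 2) * (a ^ 2 - b ^ 2) +
      2 * k * a * (a ^ 2 + b ^ 2) * (β + δ * (a ^ 2 + b ^ 2)) := by
    linear_combination (a ^ 2 - b ^ 2) * hre + 2 * a * b * him
  obtain ⟨P, hPdef⟩ : ∃ P, P = a ^ 2 + b ^ 2 := ⟨_, rfl⟩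
  have hsub : a ^ 2 - b ^ 2 = 2 * a ^ 2 - P := by rw [hPdef]; ring
  rw [hsub] at hR
  rw [← hPdef] at hP hI hR
  -- the quotient by `s² - 2as + P` is `-ε s² + h s - α/P`
  set h := -2 * (k * δ + a * ε) with hh
  have hPh : P ^ 2 * h = -2 * k * β * P - 2 * a * α := by
    rw [hh]
    linear_combination -2 * hI
  have hM : m * P = -(α + ε * P ^ 2) - 2 * a * P * h := by
    apply mul_left_cancel₀ hP.ne'
    linear_combination hR + a * hPh + a * P ^ 2 * hh
  have hkβ : 2 * k * β * P = -P ^ 2 * h - 2 * a * α := by linear_combination hPh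
  have hkδ : 2 * k * δ = -h - 2 * a * ε := by rw [hh]; ring
  have hb2 : 0 < b ^ 2 := by positivity
  have q1 : 0 ≤ -ε * P + h * P - α := by
    have e : (1 - 2 * a + P) * (-ε * P + h * P - α) = P * (m - α - ε - 2 * k * (β + δ)) := by
      linear_combination -hM + hkβ + P * hkδ
    have : 0 < 1 - 2 * a + P := by rw [hPdef]; nlinarith [sq_nonneg (a - 1)]
    exact nonneg_of_mul_nonneg_right (e ▸ mul_nonneg hP.le h1) this
  have q2 : 0 ≤ -ε * P - h * P - α := by
    have e : (1 + 2 * a + P) * (-ε * P - h * P - α) = P * (m - α - ε + 2 * k * (β + δ)) := by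
      linear_combination -hM - hkβ - P * hkδ
    have : 0 < 1 + 2 * a + P := by rw [hPdef]; nlinarith [sq_nonneg (a + 1)]
    exact nonneg_of_mul_nonneg_right (e ▸ mul_nonneg hP.le h2) this
  have hεP := mul_nonneg hε hP.le
  have hα0 : α = 0 := by linarith
  have hε0 : ε * P = 0 := by linarith
  have hh0 : h * P = 0 := by linarith
  have : m * P = 0 := by
    rw [hM, hα0]
    linear_combination -P * hε0 - 2 * a * hh0
  exact (mul_pos hm hP).ne' this

/-- If `K(x, y) = 0` with `|x| = |y|` then `y = x̄`. Writing `x = t w`, `y = t w̄` with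
`|w| = 1`, the number `t` is a root of a real quartic without nonreal roots. -/
lemma IsSmallStepWalk.eq_conj_of_kernel_eq_zero (hp : IsSmallStepWalk p) {x y : ℂ}
    (hK : kernel p x y = 0) (hxy : ‖x‖ = ‖y‖) : y = starRingEnd ℂ x := by
  by_cases hx : x = 0
  · rw [hx, norm_zero] at hxy
    rw [norm_eq_zero.1 hxy.symm, hx, map_zero]
  have hy : y ≠ 0 := fun h => by
    rw [h, norm_zero] at hxy
    exact hx (norm_eq_zero.1 hxy)
  obtain ⟨t, ht⟩ := IsAlgClosed.exists_pow_nat_eq (x * y) two_pos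
  replace ht := ht.symm
  have ht0 : t ≠ 0 := fun h => by
    rw [h] at ht
    exact mul_ne_zero hx hy (by simpa using ht)
  have htn : ‖t‖ = ‖x‖ := by
    have := congrArg norm ht
    rw [norm_mul, norm_pow, ← hxy, ← pow_two] at this
    exact ((pow_left_inj₀ (norm_nonneg _) (norm_nonneg _) two_ne_zero).1 this).symm
  obtain ⟨w, hw⟩ : ∃ w, w = x / t := ⟨_, rfl⟩
  have hxw : x = t * w := by rw [hw]; field_simp
  have hwn : ‖w‖ = 1 := by rw [hw, norm_div, htn, div_self (norm_ne_zero_iff.2 hx)]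
  have hww : w * starRingEnd ℂ w = 1 := by
    rw [Complex.mul_conj, Complex.normSq_eq_norm_sq, hwn]
    norm_num
  have hyw : y = t * starRingEnd ℂ w := by
    apply mul_left_cancel₀ hx
    rw [ht, hxw]
    linear_combination -t ^ 2 * hww
  have hsum : w + starRingEnd ℂ w = 2 * (w.re : ℂ) := by
    rw [Complex.add_conj]
    push_cast
    ring
  have hk : w.re ^ 2 ≤ 1 := by
    have := Complex.abs_re_le_norm w
    rw [hwn] at this
    exact (sq_le_one_iff_abs_le_one _).2 this
  have hk' := (sq_le_one_iff_abs_le_one _).1 hk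
  rw [abs_le] at hk'
  obtain ⟨-, -, -, -, h5, h6⟩ := hp.relations
  have hg := hp.nonneg 1 (-1)
  have hA := hp.nonneg 1 1
  have hE := hp.nonneg (-1) (-1)
  have ht_im : t.im = 0 := by
    refine quartic_root_im_eq_zero (α := p 1 1) (β := p 1 0) (δ := p (-1) 0) (ε := p (-1) (-1))
      (k := w.re) (m := p 1 1 + 2 * p 1 0 + 2 * p (-1) 0 + p (-1) (-1) +
        4 * p 1 (-1) * (1 - w.re ^ 2)) hA hE ?_ ?_ ?_ ?_
    · nlinarith [mul_nonneg hg (sub_nonneg.2 hk)]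
    · nlinarith [mul_nonneg hg (sub_nonneg.2 hk)]
    · nlinarith [mul_nonneg hg (sub_nonneg.2 hk)]
    · rw [hp.kernel_eq, hyw, hxw, h5] at hK
      push_cast at hK ⊢
      linear_combination hK + (p 1 0 * t + p (-1) 0 * t ^ 3 * (w * starRingEnd ℂ w) +
          p 1 (-1) * t ^ 2 * (w + starRingEnd ℂ w + 2 * (w.re : ℂ))) * hsum +
        (-t ^ 2 + (1 - (p 1 1 + 2 * p 1 0 + 2 * p 1 (-1) + 2 * p (-1) 0 + p (-1) (-1))) * t ^ 2
          - 2 * p 1 (-1) * t ^ 2 +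
          2 * (w.re : ℂ) * p (-1) 0 * t ^ 3 +
          p (-1) (-1) * t ^ 4 * (w * starRingEnd ℂ w + 1)) * hww
  have htc : starRingEnd ℂ t = t := Complex.conj_eq_iff_im.2 ht_im
  rw [hyw, hxw, map_mul, htc]

lemma IsSmallStepWalk.mem_curveS_iff (hp : IsSmallStepWalk p) {x : ℂ} :
    x ∈ curveS p ↔ ‖x‖ ≤ 1 ∧ diagKernel p x = 0 := by
  constructor
  · rintro ⟨y, hK, hxy, hy⟩
    have h := hp.eq_conj_of_kernel_eq_zero hK hxy
    rw [h, hp.kernel_conj] at hK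
    exact ⟨hxy ▸ hy, by exact_mod_cast hK⟩
  · rintro ⟨hx, h⟩
    exact ⟨starRingEnd ℂ x, by rw [hp.kernel_conj, h, Complex.ofReal_zero], by simp, by simpa⟩

/-! ### The angle and the branch points -/

lemma IsSmallStepWalk.sumQuad_pos (hp : IsSmallStepWalk p) : 0 < sumQuad p := by
  have := hp.relations.2.2.2.2.2
  have h1 := hp.nonneg 1 1
  have h2 := hp.nonneg (-1) (-1)
  rw [sumQuad]
  linarith

lemma IsSmallStepWalk.diffQuad_pos (hp : IsSmallStepWalk p) : 0 < diffQuad p := by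
  have := hp.relations.2.2.2.2.2
  have h1 := hp.nonneg 1 (-1)
  rw [diffQuad]
  linarith

/-- The conic `Q` is negative at the real point `u = -1/2`, that is, `K(-1, -1) > 0`. -/
lemma IsSmallStepWalk.conic_neg_half (hp : IsSmallStepWalk p) :
    sumQuad p / 4 - linCoeff p + p (-1) (-1) < 0 := by
  obtain ⟨-, -, -, h4, -, h6⟩ := hp.relations
  rw [sumQuad, linCoeff]
  linarith

/-- The line `Re u = -1/2` is closer to the centre `-linCoeff / sumQuad` of the conic than the
vertices are; in particular the right-hand side, which fixes the scale of the conic, is positive. -/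
lemma IsSmallStepWalk.sq_lt_conicDisc (hp : IsSmallStepWalk p) :
    (linCoeff p - sumQuad p / 2) ^ 2 < linCoeff p ^ 2 - p (-1) (-1) * sumQuad p := by
  have := mul_neg_of_pos_of_neg hp.sumQuad_pos hp.conic_neg_half
  nlinarith

/-- The value of `cos θ`; irreducibility excludes the degenerate angles `0` and `π`. -/
lemma IsSmallStepWalk.cos_angle (hp : IsSmallStepWalk p) :
    Real.cos (angle p) = (diffQuad p - sumQuad p) / (sumQuad p + diffQuad p) ∧
    0 < angle p ∧ angle p < Real.pi := by
  obtain ⟨h1, h2, h3, h4, -, -⟩ := hp.relations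
  have hs := hp.sumQuad_pos
  have hd := hp.diffQuad_pos
  have e1 : stepSum (fun k l => (k : ℝ) * l * p k l) = (sumQuad p - diffQuad p) / 2 := by
    rw [stepSum_eq, h2, sumQuad, diffQuad]
    push_cast
    linarith
  have e2 : stepSum (fun k l => (k : ℝ) ^ 2 * p k l) = (sumQuad p + diffQuad p) / 2 := by
    rw [stepSum_eq, h2, sumQuad, diffQuad]
    push_cast
    linarith
  have e3 : stepSum (fun k l => (l : ℝ) ^ 2 * p k l) = (sumQuad p + diffQuad p) / 2 := by
    rw [stepSum_eq, h1, h2, h3, sumQuad, diffQuad]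
    push_cast
    linarith
  have harg : -stepSum (fun k l => (k : ℝ) * l * p k l) /
    (Real.sqrt (stepSum (fun k l => (k : ℝ) ^ 2 * p k l)) *
      Real.sqrt (stepSum (fun k l => (l : ℝ) ^ 2 * p k l))) =
      (diffQuad p - sumQuad p) / (sumQuad p + diffQuad p) := by
    rw [e1, e2, e3, Real.mul_self_sqrt (by linarith)]
    field_simp
    ring
  have hlt : (diffQuad p - sumQuad p) / (sumQuad p + diffQuad p) < 1 := by
    rw [div_lt_one (by linarith)]
    linarith
  have hgt : -1 < (diffQuad p - sumQuad p) / (sumQuad p + diffQuad p) := by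
    rw [lt_div_iff₀ (by linarith)]
    linarith
  rw [angle, harg]
  refine ⟨Real.cos_arccos hgt.le hlt.le, Real.arccos_pos.2 hlt, ?_⟩
  refine lt_of_le_of_ne (Real.arccos_le_pi _) fun h => ?_
  rw [Real.arccos_eq_pi] at h
  linarith

lemma IsSmallStepWalk.sq_half_angle (hp : IsSmallStepWalk p) :
    Real.cos (angle p / 2) ^ 2 = diffQuad p / (sumQuad p + diffQuad p) ∧
    Real.sin (angle p / 2) ^ 2 = sumQuad p / (sumQuad p + diffQuad p) := by
  have hs := hp.sumQuad_pos
  have hd := hp.diffQuad_pos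
  have h : Real.cos (angle p / 2) ^ 2 = diffQuad p / (sumQuad p + diffQuad p) := by
    rw [Real.cos_sq, mul_div_cancel₀ _ two_ne_zero, hp.cos_angle.1]
    field_simp
    ring
  refine ⟨h, ?_⟩
  rw [Real.sin_sq, h]
  field_simp
  ring

open Polynomial in
/-- The discriminant expanded at its double root `1`. -/
lemma IsSmallStepWalk.kernelDisc_eq (hp : IsSmallStepWalk p) : kernelDisc p =
    (X - 1) ^ 2 * (C (linCoeff p ^ 2 - (sumQuad p + diffQuad p) * p (-1) (-1)) * (X - 1) ^ 2 -
      C (2 * linCoeff p * diffQuad p) * (X - 1) - C (sumQuad p * diffQuad p)) := by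
  obtain ⟨h1, h2, h3, h4, h5, -⟩ := hp.relations
  have hε : p (-1) (-1) = p 1 1 + p 1 0 - p (-1) 0 := by linarith
  refine Polynomial.funext fun t => ?_
  simp only [kernelDisc, kernelA, kernelB, kernelC, eval_sub, eval_pow, eval_mul, eval_neg,
    eval_add, eval_C, eval_X, eval_one, eval_ofNat]
  rw [h1, h2, h3, h5, sumQuad, diffQuad, linCoeff, hε]
  ring

open Polynomial in
/-- Comparison of coefficients at `1`, by evaluation at three other points. -/
lemma quartic_eq_iff {W G S c x r : ℝ} :
    (X - 1) ^ 2 * (C W * (X - 1) ^ 2 - C G * (X - 1) - C S) =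
      C c * (X - 1) ^ 2 * (X - C x) * (X - C r) ↔
    W = c ∧ c * ((x - 1) + (r - 1)) = G ∧ c * ((x - 1) * (r - 1)) = -S := by
  constructor
  · intro h
    have e0 := congrArg (eval 0) h
    have e2 := congrArg (eval 2) h
    have e3 := congrArg (eval 3) h
    simp only [eval_sub, eval_pow, eval_mul, eval_C, eval_X, eval_one] at e0 e2 e3
    norm_num at e0 e2 e3
    have hW : W = c := by linear_combination e3 / 12 - e2 / 2 + e0 / 6
    subst hW
    exact ⟨rfl, by linear_combination (e0 - e2) / -2, by linear_combination -(e0 + e2) / 2⟩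
  · rintro ⟨rfl, rfl, h⟩
    refine Polynomial.funext fun t => ?_
    simp only [eval_sub, eval_pow, eval_mul, eval_C, eval_X, eval_one]
    linear_combination -(t - 1) ^ 2 * h

open Polynomial in
lemma cubic_eq_iff {W G S c x : ℝ} :
    (X - 1) ^ 2 * (C W * (X - 1) ^ 2 - C G * (X - 1) - C S) =
      C c * (X - 1) ^ 2 * (X - C x) ↔ W = 0 ∧ -G = c ∧ c * (x - 1) = S := by
  constructor
  · intro h
    have e0 := congrArg (eval 0) h
    have e2 := congrArg (eval 2) h
    have e3 := congrArg (eval 3) h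
    simp only [eval_sub, eval_pow, eval_mul, eval_C, eval_X, eval_one] at e0 e2 e3
    norm_num at e0 e2 e3
    have hW : W = 0 := by linear_combination e3 / 12 - e2 / 2 + e0 / 6
    subst hW
    exact ⟨rfl, by linear_combination (e2 - e0) / 2, by linear_combination (e0 + e2) / 2⟩
  · rintro ⟨rfl, rfl, rfl⟩
    refine Polynomial.funext fun t => ?_
    simp only [eval_sub, eval_pow, eval_mul, eval_C, eval_X, eval_one]
    ring

/-- Being a pair of branch points, expressed through the coefficients of `d` at `1`. -/
lemma IsSmallStepWalk.isBranchPoints_iff (hp : IsSmallStepWalk p) {x₁ : ℝ} {x₄ : OnePoint ℝ} :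
    IsBranchPoints p x₁ x₄ ↔ (-1 ≤ x₁ ∧ x₁ < 1) ∧
      ((x₄ = ∞ ∧ linCoeff p ^ 2 - (sumQuad p + diffQuad p) * p (-1) (-1) = 0 ∧
        2 * linCoeff p * (1 - x₁) = sumQuad p) ∨
      ∃ r : ℝ, x₄ = (r : OnePoint ℝ) ∧ (1 < r ∨ r ≤ -1) ∧ ∃ c : ℝ, c ≠ 0 ∧
        linCoeff p ^ 2 - (sumQuad p + diffQuad p) * p (-1) (-1) = c ∧
        c * ((x₁ - 1) + (r - 1)) = 2 * linCoeff p * diffQuad p ∧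
        c * ((x₁ - 1) * (r - 1)) = -(sumQuad p * diffQuad p)) := by
  have hs := hp.sumQuad_pos
  have hd := hp.diffQuad_pos
  rw [IsBranchPoints, hp.kernelDisc_eq]
  simp only [quartic_eq_iff, cubic_eq_iff]
  refine and_congr_right fun _ => or_congr_left (and_congr_right fun _ => ⟨?_, ?_⟩)
  · rintro ⟨c, -, hW, rfl, h⟩
    refine ⟨hW, mul_left_cancel₀ hd.ne' ?_⟩
    linear_combination h
  · rintro ⟨hW, h⟩
    have hg : linCoeff p ≠ 0 := by
      intro h0
      rw [h0] at h
      linarith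
    exact ⟨_, neg_ne_zero.2 (mul_ne_zero (mul_ne_zero two_ne_zero hg) hd.ne'), hW, rfl,
      by linear_combination diffQuad p * h⟩

/-- Existence: the quadratic cofactor of `(x-1)²` in `d` is nonnegative at `-1` and negative
at `1`. -/
lemma IsSmallStepWalk.exists_isBranchPoints (hp : IsSmallStepWalk p) :
    ∃ (x₁ : ℝ) (x₄ : OnePoint ℝ), IsBranchPoints p x₁ x₄ := by
  obtain ⟨h1, h2, h3, h4, h5, h6⟩ := hp.relations
  have hs := hp.sumQuad_pos
  have hd := hp.diffQuad_pos
  have hsd := mul_pos hs hd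
  -- in `t = x - 1` the cofactor is `w t² - 2 * linCoeff * diffQuad * t - sumQuad * diffQuad`
  obtain ⟨w, hw⟩ : ∃ w, w = linCoeff p ^ 2 - (sumQuad p + diffQuad p) * p (-1) (-1) := ⟨_, rfl⟩
  have hq : 0 ≤ 4 * w + 4 * linCoeff p * diffQuad p - sumQuad p * diffQuad p := by
    have hε : p (-1) (-1) = p 1 1 + p 1 0 - p (-1) 0 := by linarith
    have e : 4 * w + 4 * linCoeff p * diffQuad p - sumQuad p * diffQuad p =
        (p 1 1 + p 1 0 + p 1 (-1) + (p 1 0 + p (-1) 0)) ^ 2 -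
          (p (-1) (-1) - p (-1) 0 + p 1 (-1)) * (p 1 1 - p 1 0 + p 1 (-1)) := by
      rw [hw, sumQuad, diffQuad, linCoeff, hε]
      ring
    rw [e]
    have ha := hp.nonneg 1 1
    have hb := hp.nonneg 1 0
    have hg := hp.nonneg 1 (-1)
    have hde := hp.nonneg (-1) 0
    have he := hp.nonneg (-1) (-1)
    have k1 : |p (-1) (-1) - p (-1) 0 + p 1 (-1)| ≤ p 1 1 + p 1 0 + p 1 (-1) := by
      rw [abs_le]; constructor <;> linarith
    have k2 : |p 1 1 - p 1 0 + p 1 (-1)| ≤ p 1 1 + p 1 0 + p 1 (-1) := by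
      rw [abs_le]; constructor <;> linarith
    have k3 := mul_le_mul k1 k2 (abs_nonneg _) (by positivity)
    rw [← abs_mul] at k3
    have k4 := le_abs_self ((p (-1) (-1) - p (-1) 0 + p 1 (-1)) * (p 1 1 - p 1 0 + p 1 (-1)))
    nlinarith
  rcases eq_or_ne w 0 with hw0 | hw0
  · have hg : sumQuad p ≤ 4 * linCoeff p := by
      rw [hw0] at hq
      by_contra hlt
      nlinarith [mul_pos hd (sub_pos.2 (not_le.1 hlt))]
    have hg0 : 0 < linCoeff p := by linarith
    refine ⟨1 - sumQuad p / (2 * linCoeff p), ∞, hp.isBranchPoints_iff.2 ⟨⟨?_, ?_⟩,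
      Or.inl ⟨rfl, by rw [← hw, hw0], ?_⟩⟩⟩
    · have : sumQuad p / (2 * linCoeff p) ≤ 2 := by
        rw [div_le_iff₀ (by positivity)]
        linarith
      linarith
    · have : 0 < sumQuad p / (2 * linCoeff p) := by positivity
      linarith
    · field_simp
      ring
  · obtain ⟨t, ⟨ht1, ht2⟩, ht⟩ : ∃ t ∈ Set.Icc (-2 : ℝ) 0,
        w * t ^ 2 - 2 * linCoeff p * diffQuad p * t - sumQuad p * diffQuad p = 0 := by
      have hcont : ContinuousOn (fun t : ℝ =>
          w * t ^ 2 - 2 * linCoeff p * diffQuad p * t - sumQuad p * diffQuad p)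
          (Set.Icc (-2) 0) := by fun_prop
      exact intermediate_value_Icc' (by norm_num) hcont ⟨by norm_num; linarith, by linarith⟩
    have ht0 : t < 0 := by
      refine lt_of_le_of_ne ht2 fun h => ?_
      rw [h] at ht
      linarith
    -- the second root, by Vieta's formula
    obtain ⟨r, hr⟩ : ∃ r, w * t * r = -(sumQuad p * diffQuad p) :=
      ⟨-(sumQuad p * diffQuad p) / (w * t), mul_div_cancel₀ _ (mul_ne_zero hw0 ht0.ne)⟩
    have hsum : w * (t + r) = 2 * linCoeff p * diffQuad p := by
      apply mul_left_cancel₀ ht0.ne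
      linear_combination ht + hr
    rcases hw0.lt_or_gt with hneg | hpos
    · have hr0 : r < 0 := by
        by_contra hr0
        have := mul_nonneg (mul_pos_of_neg_of_neg hneg ht0).le (not_lt.1 hr0)
        linarith
      by_cases hr2 : r ≤ -2
      · refine ⟨t + 1, ((r + 1 : ℝ) : OnePoint ℝ), hp.isBranchPoints_iff.2 ⟨⟨by linarith,
          by linarith⟩, Or.inr ⟨r + 1, rfl, Or.inr (by linarith), w, hw0, hw.symm, ?_, ?_⟩⟩⟩
        · linear_combination hsum
        · linear_combination hr
      · -- here `t = -2`, and the two roots exchange their roles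
        have ht2' : t = -2 := by
          have hm : 0 ≤ w * ((t + 2) * (r + 2)) := by
            have : w * ((t + 2) * (r + 2)) =
                4 * w + 4 * linCoeff p * diffQuad p - sumQuad p * diffQuad p := by
              linear_combination hr + 2 * hsum
            rw [this]
            exact hq
          by_contra hne
          have h' : 0 < t + 2 := by
            have : -2 < t := lt_of_le_of_ne ht1 (Ne.symm hne)
            linarith
          have := mul_neg_of_neg_of_pos hneg (mul_pos h' (by linarith : 0 < r + 2))
          linarith
        refine ⟨r + 1, ((t + 1 : ℝ) : OnePoint ℝ), hp.isBranchPoints_iff.2 ⟨⟨by linarith,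
          by linarith⟩, Or.inr ⟨t + 1, rfl, Or.inr (by linarith), w, hw0, hw.symm, ?_, ?_⟩⟩⟩
        · linear_combination hsum
        · linear_combination hr
    · have hr0 : 0 < r := by
        by_contra hr0
        have := mul_nonneg_of_nonpos_of_nonpos (mul_neg_of_pos_of_neg hpos ht0).le (not_lt.1 hr0)
        linarith
      refine ⟨t + 1, ((r + 1 : ℝ) : OnePoint ℝ), hp.isBranchPoints_iff.2 ⟨⟨by linarith,
        by linarith⟩, Or.inr ⟨r + 1, rfl, Or.inl (by linarith), w, hw0, hw.symm, ?_, ?_⟩⟩⟩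
      · linear_combination hsum
      · linear_combination hr

lemma IsSmallStepWalk.existsUnique_isBranchPoints (hp : IsSmallStepWalk p) :
    ∃! b : ℝ × OnePoint ℝ, IsBranchPoints p b.1 b.2 := by
  have hs := hp.sumQuad_pos
  have hd := hp.diffQuad_pos
  obtain ⟨x₁, x₄, hx⟩ := hp.exists_isBranchPoints
  refine ⟨(x₁, x₄), hx, ?_⟩
  rintro ⟨y₁, y₄⟩ hy
  obtain ⟨⟨hx1, hx2⟩, hx⟩ := hp.isBranchPoints_iff.1 hx
  obtain ⟨⟨hy1, hy2⟩, hy⟩ := hp.isBranchPoints_iff.1 hy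
  dsimp only at hy1 hy2 hy ⊢
  rcases hx with ⟨rfl, hw, hx⟩ | ⟨r, rfl, hr, c, hc, hcw, e1, e2⟩
  · rcases hy with ⟨rfl, -, hy⟩ | ⟨r', rfl, hr', c', hc', hcw', -⟩
    · have hg : linCoeff p ≠ 0 := by
        rintro h0
        rw [h0] at hx
        linarith
      have : y₁ = x₁ := by
        apply mul_left_cancel₀ (mul_ne_zero two_ne_zero hg)
        linear_combination hx - hy
      rw [this]
    · exact absurd (hcw'.symm.trans hw) hc'
  · rcases hy with ⟨rfl, hw, -⟩ | ⟨r', rfl, hr', c', hc', hcw', e1', e2'⟩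
    · exact absurd (hcw.symm.trans hw) hc
    · obtain rfl : c = c' := hcw.symm.trans hcw'
      have s1 : x₁ + r = y₁ + r' := by
        apply mul_left_cancel₀ hc
        linear_combination e1 - e1'
      have s2 : (x₁ - y₁) * (x₁ - r') = 0 := by
        apply mul_left_cancel₀ hc
        linear_combination c * (x₁ - 1) * s1 - e2 + e2'
      rcases mul_eq_zero.1 s2 with h | h
      · obtain rfl : x₁ = y₁ := by linarith
        obtain rfl : r = r' := by linarith
        rfl
      · -- both pairs are `(-1, -1)`
        have : r' = -1 := by rcases hr' with h' | h' <;> linarith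
        have : r = -1 := by rcases hr with h' | h' <;> linarith
        obtain rfl : x₁ = y₁ := by linarith
        obtain rfl : r = r' := by linarith
        rfl

/-! ### The Möbius map `μ` -/

lemma csqrt_sq (z : ℂ) : csqrt z ^ 2 = z := by
  rw [csqrt, one_div, show ((2 : ℂ)⁻¹) = (((2 : ℕ) : ℂ)⁻¹) by norm_num]
  exact Complex.cpow_nat_inv_pow z two_ne_zero

/-- The number `s = (A + 2√B)/D` has inverse `(A - 2√B)/D` if `A² - 4B = D²`. -/
lemma add_one_div_csqrt {A B D : ℂ} (hD : D ≠ 0) (h : A ^ 2 - 4 * B = D ^ 2) :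
    (A + 2 * csqrt B) / D + 1 / ((A + 2 * csqrt B) / D) = 2 * A / D := by
  have hs := csqrt_sq B
  have hprod : (A + 2 * csqrt B) * (A - 2 * csqrt B) = D ^ 2 := by
    linear_combination h - 4 * hs
  have hne : A + 2 * csqrt B ≠ 0 := by
    intro h0
    rw [h0, zero_mul] at hprod
    exact pow_ne_zero 2 hD hprod.symm
  field_simp
  linear_combination -hprod

/-- In the coordinate `u = 1/(x-1)` the map `μ` is an affine map `u ↦ M - N u`. The two equations
for `M` and `N` say that it takes the centre of the conic to `0` and its branch points to `±1`. -/
lemma IsSmallStepWalk.exists_mu_eq (hp : IsSmallStepWalk p) {x₁ : ℝ} {x₄ : OnePoint ℝ}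
    (h : IsBranchPoints p x₁ x₄) : ∃ M N : ℝ, 0 < N ∧
      M * sumQuad p = -(N * linCoeff p) ∧
      N ^ 2 * (sumQuad p + diffQuad p) * (linCoeff p ^ 2 - p (-1) (-1) * sumQuad p) =
        sumQuad p ^ 2 * diffQuad p ∧
      ∀ x : ℂ, x ≠ 1 → mu x₁ x₄ x = M - N / (x - 1) := by
  have hs := hp.sumQuad_pos
  have hd := hp.diffQuad_pos
  obtain ⟨⟨hx1, hx2⟩, hx⟩ := hp.isBranchPoints_iff.1 h
  rcases hx with ⟨rfl, hw, hx⟩ | ⟨r, rfl, hr, c, hc, hcw, e1, e2⟩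
  · refine ⟨-1, 2 * (1 - x₁), by linarith, by linarith, ?_, ?_⟩
    · rw [← hx] at hw ⊢
      linear_combination 4 * (1 - x₁) ^ 2 * 2 * linCoeff p * (1 - x₁) * hw
    · intro x hx
      have hx' : x - 1 ≠ 0 := sub_ne_zero.2 hx
      have h0 : muZero x₁ ∞ = -2 := by
        rw [muZero, sZero, OnePoint.elim_infty]
        norm_num
      have h1 : muOne x₁ ∞ = 2 * (1 - 2 * x₁) := by
        rw [muOne, sOne, OnePoint.elim_infty]
        have := add_one_div_csqrt (A := 1 - 2 * x₁) (B := -((x₁ : ℂ) * (1 - x₁))) (D := 1)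
          one_ne_zero (by ring)
        simpa using this
      rw [mu, h0, h1]
      push_cast
      field_simp
      ring
  · -- the cofactor of `(x-1)²` in `d` has a positive discriminant, as the conic is nondegenerate
    have hne : r - x₁ ≠ 0 := by
      intro h0
      have hrx : r = x₁ := by linarith
      rw [hrx] at e1 e2
      have hlt := hp.sq_lt_conicDisc
      have hpos : 0 < linCoeff p ^ 2 - p (-1) (-1) * sumQuad p :=
        (sq_nonneg _).trans_lt hlt
      have h1 : diffQuad p * ((sumQuad p + diffQuad p) *
          (linCoeff p ^ 2 - p (-1) (-1) * sumQuad p)) = 0 := by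
        rw [← hcw] at e1 e2
        set c' := linCoeff p ^ 2 - (sumQuad p + diffQuad p) * p (-1) (-1) with hc'
        linear_combination -sumQuad p * diffQuad p * hc' -
          (linCoeff p * diffQuad p + c' * (x₁ - 1)) / 2 * e1 + c' * e2
      have h2 : 0 < diffQuad p * ((sumQuad p + diffQuad p) *
          (linCoeff p ^ 2 - p (-1) (-1) * sumQuad p)) := by positivity
      exact h2.ne' h1
    have hne' : (r : ℂ) - x₁ ≠ 0 := by
      rw [← Complex.ofReal_sub]
      exact_mod_cast hne
    refine ⟨(2 - x₁ - r) / (r - x₁), 2 * (1 - x₁) * (r - 1) / (r - x₁), ?_, ?_, ?_, ?_⟩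
    · have h1 : 0 < 1 - x₁ := by linarith
      rcases hr with hr | hr
      · have h2 : 0 < r - 1 := by linarith
        have h3 : 0 < r - x₁ := by linarith
        positivity
      · have h3 : r - x₁ < 0 := lt_of_le_of_ne (by linarith) hne
        exact div_pos_of_neg_of_neg (mul_neg_of_pos_of_neg (by linarith) (by linarith)) h3
    · rw [div_mul_eq_mul_div, div_mul_eq_mul_div, ← neg_div]
      congr 1
      apply mul_left_cancel₀ (mul_ne_zero hc hd.ne')
      linear_combination -sumQuad p * diffQuad p * e1 - 2 * linCoeff p * diffQuad p * e2
    · rw [div_pow, div_mul_eq_mul_div, div_mul_eq_mul_div, div_eq_iff (pow_ne_zero 2 hne)]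
      apply mul_left_cancel₀ (pow_ne_zero 2 hc)
      linear_combination (4 * (sumQuad p + diffQuad p) *
          (linCoeff p ^ 2 - p (-1) (-1) * sumQuad p) *
          (c * ((x₁ - 1) * (r - 1)) - sumQuad p * diffQuad p) +
          4 * sumQuad p ^ 2 * diffQuad p * c) * e2 -
        sumQuad p ^ 2 * diffQuad p * (c * ((x₁ - 1) + (r - 1)) + 2 * linCoeff p * diffQuad p) * e1 +
        4 * sumQuad p ^ 3 * diffQuad p ^ 2 * hcw
    · intro x hx
      have hx' : x - 1 ≠ 0 := sub_ne_zero.2 hx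
      have h0 : muZero x₁ (r : OnePoint ℝ) = 2 * (2 - (x₁ + r)) / (r - x₁) := by
        rw [muZero, sZero, OnePoint.elim_some]
        exact add_one_div_csqrt hne' (by ring)
      have h1 : muOne x₁ (r : OnePoint ℝ) = 2 * (x₁ + r - 2 * x₁ * r) / (r - x₁) := by
        rw [muOne, sOne, OnePoint.elim_some]
        exact add_one_div_csqrt hne' (by ring)
      rw [mu, h0, h1]
      push_cast
      field_simp
      ring

/-! ### The curve and its interior domain -/

/-- Minus the kernel `K(x, x̄)` in the coordinate `u = 1/(x-1)`, up to the factor `|u|⁴`: a real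
conic, because `1` is a double point of the kernel. -/
noncomputable def conic (p : ℤ → ℤ → ℝ) (u : ℂ) : ℝ :=
  sumQuad p * u.re ^ 2 + 2 * linCoeff p * u.re + p (-1) (-1) - diffQuad p * u.im ^ 2

lemma IsSmallStepWalk.diagKernel_one_add_inv (hp : IsSmallStepWalk p) {u : ℂ} (hu : u ≠ 0) :
    diagKernel p (1 + u⁻¹) * Complex.normSq u ^ 2 = -conic p u := by
  obtain ⟨-, -, -, h4, h5, -⟩ := hp.relations
  have hn : Complex.normSq u ≠ 0 := fun h => hu (Complex.normSq_eq_zero.1 h)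
  have hα : p 1 1 = p (-1) 0 + p (-1) (-1) - p 1 0 := by linarith
  rw [hp.diagKernel_eq, conic, h5, sumQuad, diffQuad, linCoeff, hα]
  simp only [Complex.add_re, Complex.add_im, Complex.one_re, Complex.one_im, Complex.inv_re,
    Complex.inv_im]
  rw [Complex.normSq_apply, ← pow_two, ← pow_two] at hn ⊢
  field_simp
  ring

lemma IsSmallStepWalk.diagKernel_neg_iff (hp : IsSmallStepWalk p) {u : ℂ} (hu : u ≠ 0) :
    diagKernel p (1 + u⁻¹) < 0 ↔ 0 < conic p u := by
  have hn : 0 < Complex.normSq u ^ 2 := by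
    have := Complex.normSq_pos.2 hu
    positivity
  have h := hp.diagKernel_one_add_inv hu
  rw [← neg_neg (conic p u), ← h, neg_pos, mul_neg_iff]
  constructor
  · intro h
    exact Or.inr ⟨h, hn⟩
  · rintro (h | h)
    · linarith
    · exact h.1

lemma norm_one_add_inv_sq {u : ℂ} (hu : u ≠ 0) :
    ‖1 + u⁻¹‖ ^ 2 = 1 + (2 * u.re + 1) / Complex.normSq u := by
  have hn : Complex.normSq u ≠ 0 := fun h => hu (Complex.normSq_eq_zero.1 h)
  rw [Complex.sq_norm, Complex.normSq_apply]
  simp only [Complex.add_re, Complex.add_im, Complex.one_re, Complex.one_im, Complex.inv_re,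
    Complex.inv_im]
  rw [Complex.normSq_apply, ← pow_two, ← pow_two] at hn ⊢
  field_simp
  ring

lemma norm_one_add_inv_lt_one_iff {u : ℂ} (hu : u ≠ 0) : ‖1 + u⁻¹‖ < 1 ↔ u.re < -1 / 2 := by
  have hn := Complex.normSq_pos.2 hu
  rw [← sq_lt_one_iff₀ (norm_nonneg _), norm_one_add_inv_sq hu]
  constructor
  · intro h
    by_contra hle
    have : 0 ≤ (2 * u.re + 1) / Complex.normSq u := div_nonneg (by linarith) hn.le
    linarith
  · intro h
    have : (2 * u.re + 1) / Complex.normSq u < 0 := div_neg_of_neg_of_pos (by linarith) hn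
    linarith

/-- The part of the plane inside the right hyperbola branch, in the coordinate `u`. The line
`Re u = -1/2` passes between the two branches of the conic, so the branch may be selected by either
the line or the centre. -/
lemma IsSmallStepWalk.conic_pos_and_lt_iff (hp : IsSmallStepWalk p) {u : ℂ} (hQ : 0 < conic p u) :
    u.re < -1 / 2 ↔ sumQuad p * u.re + linCoeff p < 0 := by
  have hs := hp.sumQuad_pos
  have hd := hp.diffQuad_pos
  have hlt := hp.sq_lt_conicDisc
  have h1 : (linCoeff p - sumQuad p / 2) ^ 2 < (sumQuad p * u.re + linCoeff p) ^ 2 := by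
    have h2 : (sumQuad p * u.re + linCoeff p) ^ 2 = sumQuad p * conic p u +
        (linCoeff p ^ 2 - p (-1) (-1) * sumQuad p) + sumQuad p * diffQuad p * u.im ^ 2 := by
      rw [conic]
      ring
    have h3 := mul_pos hs hQ
    have h4 : 0 ≤ sumQuad p * diffQuad p * u.im ^ 2 := by positivity
    linarith
  constructor
  · intro h
    by_contra hle
    have : sumQuad p * u.re < sumQuad p * (-1 / 2) := by gcongr
    have h5 := pow_le_pow_left₀ (not_lt.1 hle)
      (by linarith : sumQuad p * u.re + linCoeff p ≤ linCoeff p - sumQuad p / 2) 2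
    linarith
  · intro h
    by_contra hle
    have : sumQuad p * (-1 / 2) ≤ sumQuad p * u.re :=
      mul_le_mul_of_nonneg_left (not_lt.1 hle) hs.le
    nlinarith

lemma one_add_inv_sub_one (x : ℂ) : 1 + (x - 1)⁻¹⁻¹ = x := by
  rw [inv_inv]
  ring

lemma IsSmallStepWalk.diagKernel_one (hp : IsSmallStepWalk p) : diagKernel p 1 = 0 := by
  obtain ⟨-, -, -, h4, h5, -⟩ := hp.relations
  rw [hp.diagKernel_eq, h5]
  norm_num
  linarith

lemma IsSmallStepWalk.one_mem_curveS (hp : IsSmallStepWalk p) : (1 : ℂ) ∈ curveS p :=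
  hp.mem_curveS_iff.2 ⟨by simp, hp.diagKernel_one⟩

lemma IsSmallStepWalk.continuous_diagKernel (hp : IsSmallStepWalk p) :
    Continuous (diagKernel p) := by
  rw [funext hp.diagKernel_eq]
  have h1 := Complex.continuous_re
  have h2 := Complex.continuous_im
  fun_prop

/-- A point of the complement of the curve outside the open unit disk lies in an unbounded
component: follow the ray to infinity. -/
lemma IsSmallStepWalk.not_isBounded_of_one_le_norm (hp : IsSmallStepWalk p) {x : ℂ}
    (hx : x ∉ curveS p) (h1 : 1 ≤ ‖x‖) :
    ¬ Bornology.IsBounded (connectedComponentIn (curveS p)ᶜ x) := by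
  intro hb
  have hsub : (fun t : ℝ => (t : ℂ) * x) '' Set.Ici 1 ⊆ connectedComponentIn (curveS p)ᶜ x := by
    apply IsPreconnected.subset_connectedComponentIn
    · exact isPreconnected_Ici.image _ (by fun_prop)
    · exact ⟨1, Set.self_mem_Ici, by simp⟩
    · rintro _ ⟨t, ht, rfl⟩ hmem
      rw [Set.mem_Ici] at ht
      have hn := (hp.mem_curveS_iff.1 hmem).1
      rw [norm_mul, Complex.norm_real, Real.norm_of_nonneg (by linarith)] at hn
      have ht1 : t = 1 := by
        by_contra hne
        have : 1 < t := lt_of_le_of_ne ht (Ne.symm hne)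
        nlinarith
      rw [ht1] at hmem
      exact hx (by simpa using hmem)
  obtain ⟨C, hC⟩ := (hb.subset hsub).exists_norm_le
  have := hC _ ⟨max 1 (C + 1), Set.mem_Ici.2 (le_max_left _ _), rfl⟩
  rw [norm_mul, Complex.norm_real, Real.norm_of_nonneg (by positivity)] at this
  have h2 := le_max_right 1 (C + 1)
  have h3 := le_max_left 1 (C + 1)
  nlinarith

/-- The interior domain of the curve is the part `K(x, x̄) < 0` of the unit disk. -/
lemma IsSmallStepWalk.mem_interiorS_iff (hp : IsSmallStepWalk p) {x : ℂ} :
    x ∈ interiorS p ↔ ‖x‖ < 1 ∧ diagKernel p x < 0 := by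
  have hcont := hp.continuous_diagKernel
  constructor
  · rintro ⟨hx, hb⟩
    have hn : ‖x‖ < 1 := by
      by_contra hle
      exact hp.not_isBounded_of_one_le_norm hx (not_lt.1 hle) hb
    refine ⟨hn, ?_⟩
    by_contra hle
    have hne : diagKernel p x ≠ 0 := fun h => hx (hp.mem_curveS_iff.2 ⟨hn.le, h⟩)
    have hpos : 0 < diagKernel p x := lt_of_le_of_ne (not_lt.1 hle) hne.symm
    have hx1 : x ≠ 1 := by
      rintro rfl
      simp at hn
    -- move in the coordinate `u` horizontally to the line `Re u = -1/2`, the unit circle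
    set u := (x - 1)⁻¹ with hu
    have hu0 : u ≠ 0 := inv_ne_zero (sub_ne_zero.2 hx1)
    have hxu : 1 + u⁻¹ = x := one_add_inv_sub_one x
    have hre : u.re < -1 / 2 := (norm_one_add_inv_lt_one_iff hu0).1 (hxu.symm ▸ hn)
    have hQ : conic p u < 0 := by
      have h := hp.diagKernel_one_add_inv hu0
      rw [hxu] at h
      have hn : 0 < Complex.normSq u := Complex.normSq_pos.2 hu0
      have : 0 < diagKernel p x * Complex.normSq u ^ 2 := by positivity
      linarith
    have hne0 : ∀ t ∈ Set.Icc 0 (-1 / 2 - u.re), u + (t : ℂ) ≠ 0 := by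
      intro t ht h
      have := congrArg Complex.re h
      simp at this
      linarith [ht.2]
    have hpath : IsPreconnected ((fun t : ℝ => 1 + (u + (t : ℂ))⁻¹) ''
        Set.Icc 0 (-1 / 2 - u.re)) := by
      apply isPreconnected_Icc.image
      exact continuousOn_const.add (ContinuousOn.inv₀ (by fun_prop) hne0)
    have hsub : (fun t : ℝ => 1 + (u + (t : ℂ))⁻¹) '' Set.Icc 0 (-1 / 2 - u.re) ⊆
        connectedComponentIn (curveS p)ᶜ x := by
      apply hpath.subset_connectedComponentIn
      · exact ⟨0, ⟨le_rfl, by linarith⟩, by simpa using hxu⟩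
      · rintro _ ⟨t, ht, rfl⟩ hmem
        have hk := (hp.mem_curveS_iff.1 hmem).2
        have h := hp.diagKernel_one_add_inv (hne0 t ht)
        rw [hk, zero_mul, conic] at h
        have hs := hp.sumQuad_pos
        have hd := hp.diffQuad_pos
        have hhalf := hp.conic_neg_half
        have him : 0 ≤ diffQuad p * u.im ^ 2 := by positivity
        simp only [Complex.add_re, Complex.ofReal_re, Complex.add_im, Complex.ofReal_im,
          add_zero] at h
        rw [conic] at hQ
        -- the conic is convex in `Re u` and negative at both ends of the segment
        have hconv : 0 ≤ sumQuad p * (t * (-1 / 2 - u.re - t)) :=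
          mul_nonneg hs.le (mul_nonneg ht.1 (by linarith [ht.2]))
        have hL : 0 < -1 / 2 - u.re := by linarith
        rcases ht.1.eq_or_lt with rfl | ht0
        · rw [add_zero] at h
          exact hQ.ne (by linarith only [h])
        · have h1 := mul_neg_of_pos_of_neg ht0 hhalf
          have h2 := mul_nonpos_of_nonneg_of_nonpos (sub_nonneg.2 ht.2) hQ.le
          have h3 := mul_nonneg hL.le hconv
          have h4 := mul_nonneg ht.1 him
          have h5 := congrArg (fun r => (-1 / 2 - u.re) * r) h
          linarith only [h1, h2, h3, h4, h5]
    set y := 1 + (u + ((-1 / 2 - u.re : ℝ) : ℂ))⁻¹ with hy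
    have hymem : y ∈ connectedComponentIn (curveS p)ᶜ x :=
      hsub ⟨-1 / 2 - u.re, ⟨by linarith, le_rfl⟩, rfl⟩
    have hyn : 1 ≤ ‖y‖ := by
      by_contra hlt
      have h := (norm_one_add_inv_lt_one_iff (hne0 _ ⟨by linarith, le_rfl⟩)).1 (not_le.1 hlt)
      simp at h
    rw [connectedComponentIn_eq hymem] at hb
    exact hp.not_isBounded_of_one_le_norm (connectedComponentIn_subset _ _ hymem) hyn hb
  · rintro ⟨hn, hk⟩
    have hx : x ∈ (curveS p)ᶜ := fun h => hk.ne (hp.mem_curveS_iff.1 h).2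
    refine ⟨hx, ?_⟩
    have hopen1 : IsOpen {y : ℂ | ‖y‖ < 1 ∧ diagKernel p y < 0} :=
      (isOpen_lt continuous_norm continuous_const).inter (isOpen_lt hcont continuous_const)
    have hopen2 : IsOpen {y : ℂ | 1 < ‖y‖ ∨ 0 < diagKernel p y} :=
      (isOpen_lt continuous_const continuous_norm).union (isOpen_lt continuous_const hcont)
    have hdisj : Disjoint {y : ℂ | ‖y‖ < 1 ∧ diagKernel p y < 0}
        {y : ℂ | 1 < ‖y‖ ∨ 0 < diagKernel p y} := by
      rw [Set.disjoint_left]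
      rintro y ⟨h1, h2⟩ (h | h) <;> linarith
    have hcover : connectedComponentIn (curveS p)ᶜ x ⊆ {y : ℂ | ‖y‖ < 1 ∧ diagKernel p y < 0} ∪
        {y : ℂ | 1 < ‖y‖ ∨ 0 < diagKernel p y} := by
      intro y hy
      have hy' : y ∉ curveS p := connectedComponentIn_subset _ _ hy
      by_cases h1 : 1 < ‖y‖
      · exact Or.inr (Or.inl h1)
      · by_cases h2 : 0 < diagKernel p y
        · exact Or.inr (Or.inr h2)
        · left
          have hlt : diagKernel p y < 0 := lt_of_le_of_ne (not_lt.1 h2) fun h =>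
            hy' (hp.mem_curveS_iff.2 ⟨not_lt.1 h1, h⟩)
          refine ⟨lt_of_le_of_ne (not_lt.1 h1) fun h => h2 (hp.diagKernel_pos h ?_), hlt⟩
          rintro rfl
          exact hy' hp.one_mem_curveS
    have hsub := isPreconnected_connectedComponentIn.subset_left_of_subset_union hopen1 hopen2 hdisj
      hcover ⟨x, mem_connectedComponentIn hx, hn, hk⟩
    refine (Metric.isBounded_ball (x := (0 : ℂ)) (r := 1)).subset fun y hy => ?_
    rw [mem_ball_zero_iff]
    exact (hsub hy).1

/-- The affine map `u ↦ M - N u` takes the conic to the hyperbola with foci `±1`. -/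
lemma IsSmallStepWalk.hyperbola_eq_conic (hp : IsSmallStepWalk p) {M N : ℝ}
    (h1 : M * sumQuad p = -(N * linCoeff p))
    (h2 : N ^ 2 * (sumQuad p + diffQuad p) * (linCoeff p ^ 2 - p (-1) (-1) * sumQuad p) =
      sumQuad p ^ 2 * diffQuad p) (u : ℂ) :
    (M - N * u.re) ^ 2 * Real.sin (angle p / 2) ^ 2 -
      (N * u.im) ^ 2 * Real.cos (angle p / 2) ^ 2 -
      Real.cos (angle p / 2) ^ 2 * Real.sin (angle p / 2) ^ 2 =
      N ^ 2 / (sumQuad p + diffQuad p) * conic p u := by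
  have hs := hp.sumQuad_pos
  have hd := hp.diffQuad_pos
  rw [hp.sq_half_angle.1, hp.sq_half_angle.2, conic]
  have hM : M = -(N * linCoeff p) / sumQuad p := by rw [eq_div_iff hs.ne', h1]
  have hne : sumQuad p + diffQuad p ≠ 0 := by positivity
  rw [hM]
  field_simp
  linear_combination h2

lemma IsSmallStepWalk.mu_mem_hyperbolaInterior_iff (hp : IsSmallStepWalk p) {M N : ℝ} (hN : 0 < N)
    (h1 : M * sumQuad p = -(N * linCoeff p))
    (h2 : N ^ 2 * (sumQuad p + diffQuad p) * (linCoeff p ^ 2 - p (-1) (-1) * sumQuad p) =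
      sumQuad p ^ 2 * diffQuad p) {x : ℂ} (hx : x ≠ 1) :
    (M - N / (x - 1) : ℂ) ∈ hyperbolaInterior (angle p) ↔ x ∈ interiorS p := by
  have hs := hp.sumQuad_pos
  have hd := hp.diffQuad_pos
  set u := (x - 1)⁻¹ with hu
  have hu0 : u ≠ 0 := inv_ne_zero (sub_ne_zero.2 hx)
  have hxu : 1 + u⁻¹ = x := one_add_inv_sub_one x
  have hre : (M - N / (x - 1) : ℂ).re = M - N * u.re := by
    rw [div_eq_mul_inv, ← hu]
    simp
  have him : (M - N / (x - 1) : ℂ).im = -(N * u.im) := by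
    rw [div_eq_mul_inv, ← hu]
    simp
  have hre' : sumQuad p * (M - N * u.re) = -N * (sumQuad p * u.re + linCoeff p) := by
    linear_combination h1
  have hpos : 0 < M - N * u.re ↔ sumQuad p * u.re + linCoeff p < 0 := by
    constructor
    · intro h
      have := mul_pos hs h
      rw [hre'] at this
      nlinarith
    · intro h
      have := mul_pos_of_neg_of_neg (neg_neg_of_pos hN) h
      rw [← hre'] at this
      exact (pos_iff_pos_of_mul_pos this).1 hs
  have hconic := hp.hyperbola_eq_conic h1 h2 u
  have hfac : 0 < N ^ 2 / (sumQuad p + diffQuad p) := by positivity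
  rw [hp.mem_interiorS_iff, ← hxu, norm_one_add_inv_lt_one_iff hu0, hp.diagKernel_neg_iff hu0,
    hxu, hyperbolaInterior, Set.mem_ofPred_eq, hre, him, neg_sq, hpos]
  constructor
  · rintro ⟨h3, h4⟩
    have hQ : 0 < conic p u := by
      have : 0 < N ^ 2 / (sumQuad p + diffQuad p) * conic p u := by linarith
      exact (pos_iff_pos_of_mul_pos this).1 hfac
    exact ⟨(hp.conic_pos_and_lt_iff hQ).2 h3, hQ⟩
  · rintro ⟨h3, hQ⟩
    have := mul_pos hfac hQ
    exact ⟨(hp.conic_pos_and_lt_iff hQ).1 h3, by linarith⟩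

/-! ### The conformal map -/

lemma cayley_sub_div_add {w : ℂ} (hw : w + 1 ≠ 0) : cayley ((w - 1) / (w + 1)) = w := by
  have h : (w - 1) / (w + 1) - 1 = -2 / (w + 1) := by
    field_simp
    ring
  rw [cayley, h]
  field_simp
  ring

lemma add_one_ne_zero_of_mem {w : ℂ} (hw : w ∈ rightHalfPlane) : w + 1 ≠ 0 := by
  intro h
  have h1 : 0 < w.re := hw
  have h2 := congrArg Complex.re h
  simp at h2
  linarith

/-- The inverse Cayley transform takes the right half-plane onto the unit disk. -/
lemma bijOn_sub_div_add :
    Set.BijOn (fun w : ℂ => (w - 1) / (w + 1)) rightHalfPlane (Metric.ball 0 1) := by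
  refine ⟨?_, ?_, ?_⟩
  · intro w hw
    have hw0 : 0 < w.re := hw
    rw [mem_ball_zero_iff, norm_div, div_lt_one (norm_pos_iff.2 (add_one_ne_zero_of_mem hw))]
    apply lt_of_pow_lt_pow_left₀ 2 (norm_nonneg _)
    rw [Complex.sq_norm, Complex.sq_norm, Complex.normSq_apply, Complex.normSq_apply]
    simp only [Complex.sub_re, Complex.add_re, Complex.sub_im, Complex.add_im, Complex.one_re,
      Complex.one_im]
    nlinarith
  · intro w hw v hv h
    have := congrArg cayley h
    dsimp only at this
    rwa [cayley_sub_div_add (add_one_ne_zero_of_mem hw),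
      cayley_sub_div_add (add_one_ne_zero_of_mem hv)] at this
  · intro z hz
    rw [mem_ball_zero_iff] at hz
    have hz1 : z - 1 ≠ 0 := by
      intro h
      rw [sub_eq_zero.1 h] at hz
      simp at hz
    have hmem : cayley z ∈ rightHalfPlane := by
      have hn : 0 < Complex.normSq (z - 1) := Complex.normSq_pos.2 hz1
      have h1 : z.re ^ 2 + z.im ^ 2 < 1 := by
        have := Complex.sq_norm z
        rw [Complex.normSq_apply] at this
        nlinarith [norm_nonneg z]
      have : (cayley z).re = (1 - (z.re ^ 2 + z.im ^ 2)) / Complex.normSq (z - 1) := by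
        rw [cayley, Complex.neg_re, Complex.div_re]
        simp
        field_simp
        ring
      rw [rightHalfPlane, Set.mem_ofPred_eq, this]
      exact div_pos (by linarith) hn
    refine ⟨cayley z, hmem, ?_⟩
    have h0 := add_one_ne_zero_of_mem hmem
    dsimp only
    rw [div_eq_iff h0, cayley]
    field_simp
    ring

lemma hasDerivAt_mobius (M N : ℝ) {x : ℂ} (hx : x ≠ 1) :
    HasDerivAt (fun x : ℂ => (M - N / (x - 1) : ℂ)) (N / (x - 1) ^ 2) x := by
  have hx' : x - 1 ≠ 0 := sub_ne_zero.2 hx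
  have h := (((hasDerivAt_id x).sub_const 1).inv hx').const_mul (N : ℂ)
  simpa [div_eq_mul_inv] using h.const_sub (M : ℂ)

lemma IsSmallStepWalk.linCoeff_nonneg (hp : IsSmallStepWalk p) : 0 ≤ linCoeff p := by
  have h1 := hp.nonneg (-1) 0
  have h2 := hp.nonneg (-1) (-1)
  rw [linCoeff]
  linarith

lemma IsSmallStepWalk.linCoeff_lt_sumQuad (hp : IsSmallStepWalk p) :
    linCoeff p < sumQuad p := by
  obtain ⟨-, -, -, h4, -, h6⟩ := hp.relations
  have h1 := hp.nonneg 1 1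
  have h2 := hp.nonneg 1 0
  have h3 := hp.nonneg (-1) (-1)
  rw [linCoeff, sumQuad]
  by_contra hle
  linarith

end QuarterPlane

theorem mainTheorem6 (p : ℤ → ℤ → ℝ) (hp : QuarterPlane.IsSmallStepWalk p) :
    -- the branch points exist and are unique
    (∃! b : ℝ × OnePoint ℝ, QuarterPlane.IsBranchPoints p b.1 b.2) ∧
    ∀ (x₁ : ℝ) (x₄ : OnePoint ℝ), QuarterPlane.IsBranchPoints p x₁ x₄ →
      ∀ ψ : ℂ → ℂ,
        (∀ x, ψ x = 2 * QuarterPlane.chebyshevT (Real.pi / QuarterPlane.angle p)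
          (QuarterPlane.mu x₁ x₄ x)) →
        -- `T_a` is evaluated inside its domain of definition
        (∀ x ∈ QuarterPlane.interiorS p,
          ¬((QuarterPlane.mu x₁ x₄ x).im = 0 ∧ (QuarterPlane.mu x₁ x₄ x).re ≤ -1)) ∧
        -- `ψ` is a conformal map from `𝒮₁⁺` onto the right half-plane, of the form `φ ∘ π₁`
        QuarterPlane.IsConformalOnto ψ (QuarterPlane.interiorS p) QuarterPlane.rightHalfPlane ∧
        QuarterPlane.IsPsiOne p ψ ∧
        -- up to a positive factor, it satisfies `ψ₁(0) = p_{1,1}` and `ψ₁'(0) > 0`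
        (∃ c : ℝ, 0 < c ∧ c * ψ 0 = p 1 1) ∧
        (∃ d : ℝ, 0 < d ∧ HasDerivAt ψ d 0) := by
  refine ⟨hp.existsUnique_isBranchPoints, fun x₁ x₄ hx ψ hψ => ?_⟩
  obtain ⟨M, N, hN, h1, h2, hmu⟩ := hp.exists_mu_eq hx
  obtain ⟨-, hθ0, hθπ⟩ := hp.cos_angle
  set θ := QuarterPlane.angle p with hθ
  have hs := hp.sumQuad_pos
  have hd := hp.diffQuad_pos
  have hne1 : ∀ x ∈ QuarterPlane.interiorS p, x ≠ 1 := by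
    rintro x hxS rfl
    exact hxS.1 hp.one_mem_curveS
  have hmem : ∀ x : ℂ, x ≠ 1 → (QuarterPlane.mu x₁ x₄ x ∈ QuarterPlane.hyperbolaInterior θ ↔
      x ∈ QuarterPlane.interiorS p) := fun x hx1 => by
    rw [hmu x hx1]
    exact hp.mu_mem_hyperbolaInterior_iff hN h1 h2 hx1
  have hN' : (N : ℂ) ≠ 0 := by exact_mod_cast hN.ne'
  -- the value `M` of `μ` at infinity is not positive, hence outside the right branch
  have hsolve : ∀ w ∈ QuarterPlane.hyperbolaInterior θ, 1 + N / (M - w) ≠ 1 ∧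
      QuarterPlane.mu x₁ x₄ (1 + N / (M - w)) = w := by
    intro w hw
    have hwM : (M : ℂ) - w ≠ 0 := by
      intro h
      have hM := hw.1
      rw [← sub_eq_zero.1 h, Complex.ofReal_re] at hM
      have := mul_pos hM hs
      have := mul_nonneg hN.le hp.linCoeff_nonneg
      linarith
    have hx1 : 1 + N / (M - w) ≠ 1 := by
      rw [Ne, add_eq_left]
      exact div_ne_zero hN' hwM
    refine ⟨hx1, ?_⟩
    rw [hmu _ hx1, add_sub_cancel_left, div_div_cancel₀ hN']
    ring
  -- `μ` is a bijection of the interior domain onto the interior of the hyperbola branch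
  have hmubij : Set.BijOn (QuarterPlane.mu x₁ x₄) (QuarterPlane.interiorS p)
      (QuarterPlane.hyperbolaInterior θ) := by
    refine ⟨fun x hxS => (hmem x (hne1 x hxS)).2 hxS, ?_, ?_⟩
    · intro x hxS y hyS hxy
      have hx' := sub_ne_zero.2 (hne1 x hxS)
      have hy' := sub_ne_zero.2 (hne1 y hyS)
      rw [hmu x (hne1 x hxS), hmu y (hne1 y hyS), sub_right_inj, div_eq_div_iff hx' hy'] at hxy
      exact (sub_left_inj.1 (mul_left_cancel₀ hN' hxy)).symm
    · intro w hw
      obtain ⟨hx1, hval⟩ := hsolve w hw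
      exact ⟨_, (hmem _ hx1).1 (hval.symm ▸ hw), hval⟩
  have hderψ : ∀ (x : ℂ) (d : ℂ), x ≠ 1 → HasDerivAt
      (QuarterPlane.chebyshevT (Real.pi / θ)) d (QuarterPlane.mu x₁ x₄ x) →
      HasDerivAt ψ (2 * (d * (N / (x - 1) ^ 2))) x := by
    intro x d hx1 hd
    have hm : HasDerivAt (QuarterPlane.mu x₁ x₄) (N / (x - 1) ^ 2) x := by
      refine (QuarterPlane.hasDerivAt_mobius M N hx1).congr_of_eventuallyEq ?_
      filter_upwards [isOpen_ne.mem_nhds hx1] with y hy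
      exact hmu y hy
    rw [funext hψ]
    exact (hd.comp x hm).const_mul 2
  have hdomain : ∀ x ∈ QuarterPlane.interiorS p,
      QuarterPlane.mu x₁ x₄ x ∈ QuarterPlane.chebyshevDomain := fun x hxS =>
    QuarterPlane.hyperbolaInterior_subset_chebyshevDomain θ (hmubij.mapsTo hxS)
  have hconf : QuarterPlane.IsConformalOnto ψ (QuarterPlane.interiorS p)
      QuarterPlane.rightHalfPlane := by
    constructor
    · intro x hxS
      exact (hderψ x _ (hne1 x hxS) (QuarterPlane.hasDerivAt_chebyshevT _
        (hdomain x hxS))).differentiableAt.differentiableWithinAt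
    · have hdouble : Set.BijOn (fun w : ℂ => 2 * w) QuarterPlane.rightHalfPlane
          QuarterPlane.rightHalfPlane := by
        refine ⟨fun w hw => ?_, fun w _ v _ h => mul_left_cancel₀ two_ne_zero h, fun w hw =>
          ⟨w / 2, ?_, mul_div_cancel₀ w two_ne_zero⟩⟩
        · have : 0 < w.re := hw
          simpa [QuarterPlane.rightHalfPlane] using this
        · have : 0 < w.re := hw
          simpa [QuarterPlane.rightHalfPlane] using this
      rw [funext hψ]
      exact hdouble.comp ((QuarterPlane.chebyshevT_bijOn hθ0 hθπ).comp hmubij)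
  -- the value and the derivative at the origin
  obtain ⟨X₀, hX₀⟩ : ∃ X₀ : ℝ, X₀ = M + N := ⟨_, rfl⟩
  have hmu0 : QuarterPlane.mu x₁ x₄ 0 = X₀ := by
    rw [hmu 0 zero_ne_one, hX₀]
    push_cast
    ring
  have hc0 : 0 < Real.cos (θ / 2) := Real.cos_pos_of_mem_Ioo ⟨by linarith, by linarith⟩
  have hX₀pos : 0 < X₀ := by
    have h3 : X₀ * QuarterPlane.sumQuad p =
        N * (QuarterPlane.sumQuad p - QuarterPlane.linCoeff p) := by
      rw [hX₀]
      linear_combination h1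
    have h4 := mul_pos hN (sub_pos.2 hp.linCoeff_lt_sumQuad)
    rw [← h3] at h4
    exact (pos_iff_pos_of_mul_pos h4).2 hs
  -- the origin corresponds to `u = -1`, where the conic takes the value `-K(0, 0)`
  have hX₀sq : (X₀ ^ 2 - Real.cos (θ / 2) ^ 2) * QuarterPlane.sumQuad p = N ^ 2 * p 1 1 := by
    have h3 := hp.hyperbola_eq_conic h1 h2 (-1)
    have h4 : QuarterPlane.conic p (-1) = p 1 1 := by
      obtain ⟨-, -, -, h4, -, -⟩ := hp.relations
      rw [QuarterPlane.conic, QuarterPlane.sumQuad, QuarterPlane.linCoeff]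
      simp
      linarith
    rw [h4, hp.sq_half_angle.2] at h3
    have hne : QuarterPlane.sumQuad p + QuarterPlane.diffQuad p ≠ 0 := by positivity
    simp only [Complex.neg_re, Complex.one_re, Complex.neg_im, Complex.one_im] at h3
    field_simp at h3
    rw [hX₀]
    linear_combination h3
  have h11 := hp.nonneg 1 1
  have hX₀ge : Real.cos (θ / 2) ≤ X₀ := by
    by_contra hlt
    have h3 := mul_neg_of_neg_of_pos
      (sub_neg.2 (pow_lt_pow_left₀ (not_le.1 hlt) hX₀pos.le two_ne_zero)) hs
    have : 0 ≤ N ^ 2 * p 1 1 := by positivity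
    linarith
  obtain ⟨⟨d₀, hd₀, hder₀⟩, hval0, hvalpos⟩ := QuarterPlane.chebyshevT_real hθ0 hθπ hX₀ge
  refine ⟨hdomain, hconf, ?_, ?_, ?_⟩
  · -- the base point corresponds to `cos (θ/3)`, where `2 T_{π/θ}` equals `1`
    have hcos3 : ((Real.cos (θ / 3) : ℝ) : ℂ) ∈ QuarterPlane.hyperbolaInterior θ := by
      refine (QuarterPlane.mem_hyperbolaInterior_iff hθ0 hθπ).2 ⟨(θ / 3 : ℝ), ?_, by simp⟩
      rw [Complex.ofReal_re, abs_of_pos (by positivity)]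
      linarith
    obtain ⟨hx1, hval⟩ := hsolve _ hcos3
    obtain ⟨a, ha⟩ : ∃ a : ℝ, a = 1 + N / (M - Real.cos (θ / 3)) := ⟨_, rfl⟩
    have hac : (1 + N / (M - (Real.cos (θ / 3) : ℝ)) : ℂ) = a := by
      rw [ha]
      push_cast
      rfl
    rw [hac] at hx1 hval
    have haS : (a : ℂ) ∈ QuarterPlane.interiorS p := (hmem _ hx1).1 (hval.symm ▸ hcos3)
    have hψa : ψ a = 1 := by
      rw [hψ, hval, Complex.ofReal_cos, (QuarterPlane.chebyshevT_spec _).2 _ (by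
        rw [Complex.ofReal_re, abs_of_pos (by positivity)]
        linarith), ← Complex.ofReal_mul,
        show Real.pi / θ * (θ / 3) = Real.pi / 3 by field_simp, ← Complex.ofReal_cos,
        Real.cos_pi_div_three]
      norm_num
    obtain ⟨⟨d₁, hd₁, hder₁⟩, -⟩ := QuarterPlane.chebyshevT_real hθ0 hθπ
      (x := Real.cos (θ / 3)) (Real.cos_le_cos_of_nonneg_of_le_pi (by linarith) (by linarith)
        (by linarith))
    have hψ' := hderψ a d₁ hx1 (hval.symm ▸ hder₁)
    refine ⟨a, haS, fun x => (ψ x - 1) / (ψ x + 1), ⟨?_, ?_⟩, ?_, ?_, ?_⟩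
    · exact (hconf.1.sub_const 1).div (hconf.1.add_const 1) fun x hxS =>
        QuarterPlane.add_one_ne_zero_of_mem (hconf.2.mapsTo hxS)
    · exact QuarterPlane.bijOn_sub_div_add.comp hconf.2
    · simp [hψa]
    · have ha1 : a - 1 ≠ 0 := fun h => hx1 (by rw [sub_eq_zero.1 h, Complex.ofReal_one])
      refine ⟨d₁ * (N / (a - 1) ^ 2), by positivity, ?_⟩
      have h3 := ((hψ'.sub_const 1).div (hψ'.add_const 1) (by rw [hψa]; norm_num)).deriv
      refine h3.trans ?_
      rw [hψa]
      push_cast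
      ring
    · intro x hxS
      exact (QuarterPlane.cayley_sub_div_add
        (QuarterPlane.add_one_ne_zero_of_mem (hconf.2.mapsTo hxS))).symm
  · rcases h11.eq_or_lt with h0 | h0
    · refine ⟨1, one_pos, ?_⟩
      have hX₀eq : X₀ = Real.cos (θ / 2) := by
        rw [← h0, mul_zero] at hX₀sq
        have h3 := (mul_eq_zero.1 hX₀sq).resolve_right hs.ne'
        exact (pow_left_inj₀ hX₀pos.le hc0.le two_ne_zero).1 (sub_eq_zero.1 h3)
      rw [hψ, hmu0, hval0 hX₀eq, ← h0]
      simp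
    · have hX₀gt : Real.cos (θ / 2) < X₀ := by
        refine lt_of_le_of_ne hX₀ge fun h => ?_
        rw [h, sub_self, zero_mul] at hX₀sq
        have : 0 < N ^ 2 * p 1 1 := by positivity
        linarith
      obtain ⟨t, ht, hTt⟩ := hvalpos hX₀gt
      refine ⟨p 1 1 / (2 * t), by positivity, ?_⟩
      have ht' : (t : ℂ) ≠ 0 := by exact_mod_cast ht.ne'
      rw [hψ, hmu0, hTt]
      push_cast
      field_simp
  · refine ⟨2 * (d₀ * N), by positivity, ?_⟩
    have h3 := hderψ 0 d₀ zero_ne_one (hmu0.symm ▸ hder₀)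
    convert h3 using 1
    push_cast
    ring
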